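/- **Setting.** All graphs are finite and undirected, with nonnegative edge lengths. $B_r(v)$ is the set of vertices at distance less than $r$ from $v$. The *highway dimension* of $G=(V,E)$ is the smallest $h$ such that for all $r>0$ and all $v\in V$ there is $H\subseteq V$ with $|H|\le h$ that meets every shortest path of length at least $r$ contained in $B_{4r}(v)$. **The graph $G_{t,k,q}$.** Let $t,k\ge 2$ and $q\geq 1$. Take the complete $t$-ary tree of height $k$, and let $\lambda(v)$ be the height of a node $v$ (leaves have height $0$). The vertices of $G_{t,k,q}$ are the copies $v^{(a)}$ of the tree nodes $v$, $1\le a\le q$. For each $a$, and whenever $w$ is a proper ancestor of $v$, there is an edge $v^{(a)}$–$w^{(a)}$ of length $16^{\lambda(w)-1}$; for each $v$ and all $a\ne b$ there is an edge $v^{(a)}$–$v^{(b)}$ of length $2^{\lambda(v)-k-1}$. **Contraction hierarchies.** Given an ordering of $V$ (the contraction ordering), the vertices are contracted in this order. Contracting $v$ deletes $v$ from the current graph and, for every two neighbours $u,w$ of $v$ whose distance after the deletion exceeds the length of the path $u$–$v$–$w$, adds a shortcut edge $u$–$w$ with the length of that path. Let $G^+=(V,E\cup E^+)$, where $E^+$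 is the set of all shortcuts. An $s$–$t$ query runs Dijkstra's algorithm in $G^+$ from $s$ and from $t$, at each vertex $v$ considering only edges $v$–$w$ for which $w$ was contracted after $v$, until neither search has any vertex left to consider. Its query time is the number of steps of the two searches: one for each vertex settled and one for each edge scanned. The average query time is the average over all pairs $(s,t)\in V\times V$. **Theorem.** There are absolute constants $c,C_1,C_2>0$ such that for all integers $h\ge 1$ and $n\geq 0$ and all real $D\ge 1$ there are integers $t,k\ge2$ such that $G=G_{t,k,h}$ has highway dimension exactly $h$, diameter between $C_1D$ and $C_2D$, and at least $n$ vertices, and for every contraction ordering the average query time on $G$ is at least $c\,(h\log D)^2$. The same holds with integral edge lengths: for all such $h,D,n$ there are also integers $t,k\ge 2$ such that $G_{t,k,h}$ with all lengths multiplied by $2^{k+1}$, a graph with integral edge lengths, has all these properties. -/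

import Mathlib

open scoped NNReal ENNReal

/-- An undirected graph with nonnegative edge lengths.  Only the values of `len` on edges matter. -/
structure LenGraph (V : Type) where
  graph : SimpleGraph V
  len : V → V → ℝ≥0
  len_symm : ∀ u v, len u v = len v u

namespace LenGraph

section Metric

variable {V : Type} (G : LenGraph V)

/-- The length of a walk: the sum of the lengths of its edges. -/
noncomputable def walkLen {u v : V} (p : G.graph.Walk u v) : ℝ≥0 :=
  (p.darts.map fun d => G.len d.fst d.snd).sum

/-- Shortest-path distance; it is `⊤` if there is no path. -/
noncomputable def dist (u v : V) : ℝ≥0∞ :=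
  ⨅ p : G.graph.Walk u v, (G.walkLen p : ℝ≥0∞)

theorem walkLen_reverse {u v : V} (p : G.graph.Walk u v) :
    G.walkLen p.reverse = G.walkLen p := by
  unfold walkLen
  rw [SimpleGraph.Walk.darts_reverse, List.map_reverse, List.sum_reverse, List.map_map]
  congr 2
  funext d
  exact G.len_symm _ _

theorem dist_comm (u v : V) : G.dist u v = G.dist v u := by
  refine le_antisymm (le_iInf fun p => ?_) (le_iInf fun p => ?_) <;>
  · rw [← G.walkLen_reverse p]
    exact iInf_le _ p.reverse

/-- The diameter, the largest distance between two vertices (`⊤` if `G` is disconnected). -/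
noncomputable def diam : ℝ≥0∞ := ⨆ u, ⨆ v, G.dist u v

/-- The path `p` is a shortest path between its endpoints. -/
def IsShortest {u v : V} (p : G.graph.Walk u v) : Prop :=
  p.IsPath ∧ (G.walkLen p : ℝ≥0∞) = G.dist u v

/-- The ball `B_r(v)`: all `u` with `dist u v < r`. -/
def ball (v : V) (r : ℝ≥0) : Set V := {u | G.dist u v < r}

/-- For all `r > 0` and all `v`, at most `h` vertices cover all shortest paths of length at least
`r` that lie in `B_{4r}(v)`. -/
def HighwayBound (h : ℕ) : Prop :=
  ∀ r : ℝ≥0, 0 < r → ∀ v : V, ∃ H : Finset V, H.card ≤ h ∧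
    ∀ (x y : V) (p : G.graph.Walk x y), G.IsShortest p → r ≤ G.walkLen p →
      (∀ z ∈ p.support, z ∈ G.ball v (4 * r)) → ∃ z ∈ p.support, z ∈ H

/-- The highway dimension: the smallest `h` with `HighwayBound h`. -/
noncomputable def highwayDimension : ℕ := sInf {h | G.HighwayBound h}

/-- All edge lengths are integers. -/
def IsIntegral : Prop := ∀ u v, G.graph.Adj u v → ∃ m : ℕ, G.len u v = m

/-- The same graph with all edge lengths multiplied by `m`. -/
noncomputable def scale (m : ℝ≥0) : LenGraph V where
  graph := G.graph
  len u v := m * G.len u v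
  len_symm u v := by rw [G.len_symm]

/-- `G` with the vertex `v` deleted.  The vertex type is kept, `v` just becomes isolated. -/
def deleteVertex (v : V) : LenGraph V where
  graph :=
    { Adj := fun u w => G.graph.Adj u w ∧ u ≠ v ∧ w ≠ v
      symm := ⟨fun _ _ h => ⟨h.1.symm, h.2.2, h.2.1⟩⟩
      loopless := ⟨fun u h => G.graph.loopless.irrefl u h.1⟩ }
  len := G.len
  len_symm := G.len_symm

/-- When `v` is contracted in `G`, an edge between its neighbours `u` and `w` is needed to preserve
shortest path lengths: after deletion of `v` the distance between `u` and `w` exceeds the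
length of `u`--`v`--`w`. -/
def NeedsShortcut (v u w : V) : Prop :=
  u ≠ w ∧ G.graph.Adj u v ∧ G.graph.Adj v w ∧
    ((G.len u v + G.len v w : ℝ≥0) : ℝ≥0∞) < (G.deleteVertex v).dist u w

theorem NeedsShortcut.symm {G : LenGraph V} {v u w : V} (h : G.NeedsShortcut v u w) :
    G.NeedsShortcut v w u := by
  obtain ⟨h1, h2, h3, h4⟩ := h
  refine ⟨h1.symm, h3.symm, h2.symm, ?_⟩
  rwa [dist_comm, add_comm, G.len_symm w v, G.len_symm v u]

open Classical in
/-- Add to `A` the shortcut edges that contracting `v` in `R` makes necessary; the shortcut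
`u`--`w` gets the length of the path `u`--`v`--`w`. -/
noncomputable def addShortcuts (A R : LenGraph V) (v : V) : LenGraph V where
  graph :=
    { Adj := fun u w => A.graph.Adj u w ∨ R.NeedsShortcut v u w
      symm := ⟨fun _ _ h => h.imp (fun h => h.symm) (fun h => h.symm)⟩
      loopless := ⟨fun u h => h.elim (A.graph.loopless.irrefl u) (fun h => h.1 rfl)⟩ }
  len u w := if R.NeedsShortcut v u w then R.len u v + R.len v w else A.len u w
  len_symm u w := by
    by_cases h : R.NeedsShortcut v u w
    · rw [if_pos h, if_pos h.symm, add_comm, R.len_symm u v, R.len_symm v w]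
    · rw [if_neg h, if_neg (fun h' => h h'.symm), A.len_symm]

/-- Contraction of `v`: delete `v` and add the needed shortcuts between its neighbours. -/
noncomputable def contract (v : V) : LenGraph V := (G.deleteVertex v).addShortcuts G v

end Metric

section ContractionHierarchies

variable {V : Type} [Fintype V] (G : LenGraph V)

/-- A contraction ordering: `θ i` is the vertex that is contracted in round `i`. -/
abbrev Ordering (V : Type) [Fintype V] : Type := Fin (Fintype.card V) ≃ V

/-- The graph that remains after the first `i` contractions. -/
noncomputable def remaining (θ : Ordering V) : ℕ → LenGraph V
  | 0 => G
  | i + 1 =>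
    if h : i < Fintype.card V then (remaining θ i).contract (θ ⟨i, h⟩) else remaining θ i

/-- `G` together with all shortcuts that were created in the first `i` contractions. -/
noncomputable def augmented (θ : Ordering V) : ℕ → LenGraph V
  | 0 => G
  | i + 1 =>
    if h : i < Fintype.card V then
      (augmented θ i).addShortcuts (G.remaining θ i) (θ ⟨i, h⟩)
    else augmented θ i

/-- The graph `G⁺ = (V, E ∪ E⁺)` that the preprocessing phase produces. -/
noncomputable def plus (θ : Ordering V) : LenGraph V := G.augmented θ (Fintype.card V)

open Classical in
/-- The edges `v`--`w` of `G⁺` that the search considers at `v`: those in which `w` was contracted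
after `v`. -/
noncomputable def upward (θ : Ordering V) (v : V) : Finset V :=
  Finset.univ.filter fun w => (G.plus θ).graph.Adj v w ∧ θ.symm v < θ.symm w

/-- State of a Dijkstra search: the settled vertices, and the tentative distances (`⊤` for a vertex
that has not been reached). -/
structure SearchState (V : Type) where
  settled : Finset V
  label : V → ℝ≥0∞

open Classical in
/-- At the start of a search from `s` only `s` has been reached. -/
noncomputable def SearchState.init (s : V) : SearchState V where
  settled := ∅
  label v := if v = s then 0 else ⊤

open Classical in
/-- The priority queue: the vertices that have been reached but not settled. -/
noncomputable def SearchState.queue (S : SearchState V) : Finset V :=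
  Finset.univ.filter fun v => v ∉ S.settled ∧ S.label v ≠ ⊤

open Classical in
/-- Settle `v` and relax all upward edges at `v`. -/
noncomputable def settle (θ : Ordering V) (S : SearchState V) (v : V) : SearchState V where
  settled := insert v S.settled
  label w :=
    if w ∈ G.upward θ v then min (S.label w) (S.label v + (G.plus θ).len v w) else S.label w

/-- Run Dijkstra's algorithm on the upward edges from the state `S` until the queue is empty (at
most `fuel` vertices are settled), and return the number of steps: one for every settled vertex
and one for every edge that is scanned. -/
noncomputable def searchSteps (θ : Ordering V) : ℕ → SearchState V → ℕ
  | 0, _ => 0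
  | fuel + 1, S =>
    if h : S.queue.Nonempty then
      let v := (Finset.exists_min_image S.queue S.label h).choose
      1 + (G.upward θ v).card + searchSteps θ fuel (G.settle θ S v)
    else 0

/-- The number of steps of the query `s`--`t`: the steps of the forward search from `s` and of the
backward search from `t`, both run until their queues are empty.  As a vertex is settled at
most once, `Fintype.card V` iterations exhaust either queue. -/
noncomputable def queryTime (θ : Ordering V) (s t : V) : ℕ :=
  G.searchSteps θ (Fintype.card V) (SearchState.init s) +
    G.searchSteps θ (Fintype.card V) (SearchState.init t)

/-- The average of the query time over all pairs `(s, t)` of vertices. -/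
noncomputable def avgQueryTime (θ : Ordering V) : ℝ :=
  (∑ s : V, ∑ t : V, (G.queryTime θ s t : ℝ)) / (Fintype.card V : ℝ) ^ 2

end ContractionHierarchies

end LenGraph

/-- The nodes of the complete `t`-ary tree of height `k`: a node of depth `d ≤ k` is the sequence of
the `d` choices of a child on the way from the root to it. -/
abbrev TreeNode (t k : ℕ) : Type := Σ d : Fin (k + 1), Fin (d : ℕ) → Fin t

/-- The height of a node; leaves have height `0` and the root has height `k`. -/
def TreeNode.height {t k : ℕ} (v : TreeNode t k) : ℕ := k - (v.1 : ℕ)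

/-- `w` is a proper ancestor of `v`: a proper initial segment of it. -/
def TreeNode.ProperAncestor {t k : ℕ} (w v : TreeNode t k) : Prop :=
  ∃ h : (w.1 : ℕ) < (v.1 : ℕ), ∀ i : Fin (w.1 : ℕ), v.2 (Fin.castLE h.le i) = w.2 i

/-- The graph `G_{t,k,q}`, whose vertex `(v, a)` is the copy `v^{(a)}` of the tree node `v`.  Within a
copy, a node is joined to each proper ancestor `w` by an edge of length `16 ^ (λ(w) - 1)` (and
`λ(w)` is the larger height of the two); copies `(v, a)` and `(v, b)` with `a ≠ b` are joined by an
edge of length `2 ^ (λ(v) - k - 1)`. -/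
noncomputable def treeCopiesGraph (t k q : ℕ) : LenGraph (TreeNode t k × Fin q) where
  graph :=
    { Adj := fun x y =>
        (x.2 = y.2 ∧ (TreeNode.ProperAncestor x.1 y.1 ∨ TreeNode.ProperAncestor y.1 x.1)) ∨
          (x.1 = y.1 ∧ x.2 ≠ y.2)
      symm := ⟨fun _ _ h =>
        h.imp (fun h => ⟨h.1.symm, h.2.symm⟩) (fun h => ⟨h.1.symm, h.2.symm⟩)⟩
      loopless := ⟨fun _ h =>
        h.elim (fun h => h.2.elim (fun h => lt_irrefl _ h.1) (fun h => lt_irrefl _ h.1))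
          (fun h => h.2 rfl)⟩ }
  len x y :=
    if x.2 = y.2 then 16 ^ (max (TreeNode.height x.1) (TreeNode.height y.1) - 1)
    else 2 ^ (max (TreeNode.height x.1) (TreeNode.height y.1)) / 2 ^ (k + 1)
  len_symm x y := by
    rw [max_comm]
    exact if_congr eq_comm rfl rfl

/-! Distances are explicit (`dist_scale`): up to a common factor they equal `copyDist`, the climb to
the lowest common ancestor and down again, plus, if the copies differ, one change of copy at the
lower endpoint, where it is cheapest.

Highway dimension. Edge lengths grow by a factor 16 per level, so a shortest path of length at least
`r` inside a ball of radius `4r` about `v` must meet a copy of one particular tree node, namely `v`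
or an ancestor of `v` whose height is fixed by `r`. Its `q` copies cover all such paths
(`highwayBound_scale`). Conversely, one edge from the root to a child in each copy gives `q`
disjoint long paths in one ball (`le_of_highwayBound_scale`).

Query time. Fix a leaf and its root path. If in every copy the vertices of this path are contracted
from bottom to top, then for heights `i < j` and copies `b ≠ c` uniqueness of shortest paths forces
one of two edges between copies `b` and `c` of the path (`adj_plus_cross`, `adj_plus_or`). A search
from a copy of the leaf scans all such edges among the copies ranked above its start, and summing
over the starts gives order `q³k²` steps. If the order is violated, an ancestor `v` is contracted
before some `u` below it. The nodes at the level of `u`, one in each branch below `v`, that are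
contracted after `v` are then pairwise joined in `G⁺`. Hence all but few of them have large upward
degree (`card_bad_line_le`), and such a degree alone makes the search from the leaf expensive. For
large `t` at most half of the leaves escape both cases, so the average is of order `(qk)²`. The
diameter is exponential in `k`, so `k` is of order at least `log D`. -/

namespace LenGraph

/-! ### Walk lengths and distances in graphs. -/

section DistanceBasics

variable {V : Type} (G : LenGraph V)

@[simp] theorem walkLen_nil (u : V) : G.walkLen (SimpleGraph.Walk.nil : G.graph.Walk u u) = 0 := by
  simp [walkLen]

@[simp] theorem walkLen_cons {u v w : V} (h : G.graph.Adj u v) (p : G.graph.Walk v w) :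
    G.walkLen (SimpleGraph.Walk.cons h p) = G.len u v + G.walkLen p := by
  simp [walkLen]

theorem walkLen_append {u v w : V} (p : G.graph.Walk u v) (p' : G.graph.Walk v w) :
    G.walkLen (p.append p') = G.walkLen p + G.walkLen p' := by
  simp [walkLen, SimpleGraph.Walk.darts_append]

theorem dist_le_walkLen {u v : V} (p : G.graph.Walk u v) : G.dist u v ≤ G.walkLen p :=
  iInf_le _ p

@[simp] theorem dist_self (u : V) : G.dist u u = 0 := by
  simpa using G.dist_le_walkLen (SimpleGraph.Walk.nil : G.graph.Walk u u)

theorem dist_le_len {u v : V} (h : G.graph.Adj u v) : G.dist u v ≤ G.len u v := by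
  simpa using G.dist_le_walkLen (SimpleGraph.Walk.cons h SimpleGraph.Walk.nil)

theorem dist_triangle (u v w : V) : G.dist u w ≤ G.dist u v + G.dist v w := by
  unfold dist
  refine ENNReal.le_iInf_add_iInf fun p p' => ?_
  refine (iInf_le _ (p.append p')).trans ?_
  rw [walkLen_append, ENNReal.coe_add]

/-- A function that satisfies the triangle inequality along edges bounds walk lengths from below. -/
theorem potential_le_walkLen (δ : V → V → ℝ≥0∞) (h0 : ∀ x, δ x x = 0)
    (h1 : ∀ x y z, G.graph.Adj x y → δ x z ≤ G.len x y + δ y z) {u v : V}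
    (p : G.graph.Walk u v) : δ u v ≤ G.walkLen p := by
  induction p with
  | nil => simp [h0]
  | cons h p ih =>
    rw [walkLen_cons, ENNReal.coe_add]
    exact (h1 _ _ _ h).trans (add_le_add le_rfl ih)

theorem potential_le_dist (δ : V → V → ℝ≥0∞) (h0 : ∀ x, δ x x = 0)
    (h1 : ∀ x y z, G.graph.Adj x y → δ x z ≤ G.len x y + δ y z) (u v : V) :
    δ u v ≤ G.dist u v :=
  le_iInf fun p => G.potential_le_walkLen δ h0 h1 p

end DistanceBasics

/-! ### Which shortcuts a contraction ordering must create. -/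

section Shortcuts

variable {V : Type} [Fintype V] (G : LenGraph V) (θ : Ordering V)

theorem remaining_succ {i : ℕ} (h : i < Fintype.card V) :
    G.remaining θ (i + 1) = (G.remaining θ i).contract (θ ⟨i, h⟩) := by
  rw [remaining, dif_pos h]

theorem augmented_succ {i : ℕ} (h : i < Fintype.card V) :
    G.augmented θ (i + 1) = (G.augmented θ i).addShortcuts (G.remaining θ i) (θ ⟨i, h⟩) := by
  rw [augmented, dif_pos h]

/-- Edges of the remaining graphs are never shorter than distances in the input graph. -/
theorem dist_le_len_remaining (i : ℕ) :
    ∀ u w, (G.remaining θ i).graph.Adj u w → G.dist u w ≤ (G.remaining θ i).len u w := by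
  induction i with
  | zero => exact fun u w h => G.dist_le_len h
  | succ i ih =>
    intro u w huw
    by_cases h : i < Fintype.card V
    · rw [remaining_succ G θ h] at huw ⊢
      set v := θ ⟨i, h⟩
      by_cases hn : (G.remaining θ i).NeedsShortcut v u w
      · have : ((G.remaining θ i).contract v).len u w =
            (G.remaining θ i).len u v + (G.remaining θ i).len v w := if_pos hn
        rw [this, ENNReal.coe_add]
        exact (G.dist_triangle u v w).trans (add_le_add (ih _ _ hn.2.1) (ih _ _ hn.2.2.1))
      · have : ((G.remaining θ i).contract v).len u w = (G.remaining θ i).len u w := if_neg hn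
        rw [this]
        exact ih _ _ (huw.resolve_right hn).1
    · rw [remaining, dif_neg h] at huw ⊢
      exact ih _ _ huw

/-- Edges of the input graph survive, without growing, as long as their endpoints do. -/
theorem adj_remaining {u w : V} (huw : G.graph.Adj u w) (i : ℕ) (hu : i ≤ (θ.symm u : ℕ))
    (hw : i ≤ (θ.symm w : ℕ)) :
    (G.remaining θ i).graph.Adj u w ∧ (G.remaining θ i).len u w ≤ G.len u w := by
  induction i with
  | zero => exact ⟨huw, le_rfl⟩
  | succ i ih =>
    obtain ⟨h1, h2⟩ := ih (by omega) (by omega)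
    have h : i < Fintype.card V := by have := (θ.symm u).2; omega
    rw [remaining_succ G θ h]
    set v := θ ⟨i, h⟩ with hv
    have huv : u ≠ v := by
      rintro rfl
      rw [hv, Equiv.symm_apply_apply] at hu
      simp at hu
    have hwv : w ≠ v := by
      rintro rfl
      rw [hv, Equiv.symm_apply_apply] at hw
      simp at hw
    refine ⟨Or.inl ⟨h1, huv, hwv⟩, ?_⟩
    by_cases hn : (G.remaining θ i).NeedsShortcut v u w
    · have : ((G.remaining θ i).contract v).len u w =
          (G.remaining θ i).len u v + (G.remaining θ i).len v w := if_pos hn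
      rw [this]
      refine le_trans ?_ h2
      have h3 := hn.2.2.2.le.trans
        (((G.remaining θ i).deleteVertex v).dist_le_len (u := u) (v := w) ⟨h1, huv, hwv⟩)
      exact ENNReal.coe_le_coe.1 h3
    · have : ((G.remaining θ i).contract v).len u w = (G.remaining θ i).len u w := if_neg hn
      rwa [this]

theorem adj_augmented_succ {i : ℕ} {u w : V} (h : (G.augmented θ i).graph.Adj u w) :
    (G.augmented θ (i + 1)).graph.Adj u w := by
  by_cases hi : i < Fintype.card V
  · rw [augmented_succ G θ hi]
    exact Or.inl h
  · rwa [augmented, dif_neg hi]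

theorem adj_augmented_mono {i j : ℕ} (hij : i ≤ j) {u w : V}
    (h : (G.augmented θ i).graph.Adj u w) : (G.augmented θ j).graph.Adj u w := by
  induction j, hij using Nat.le_induction with
  | base => exact h
  | succ j _ ih => exact G.adj_augmented_succ θ ih

theorem adj_augmented_of_adj_remaining (i : ℕ) :
    ∀ {u w : V}, (G.remaining θ i).graph.Adj u w → (G.augmented θ i).graph.Adj u w := by
  induction i with
  | zero => exact fun h => h
  | succ i ih =>
    intro u w h
    by_cases hi : i < Fintype.card V
    · rw [remaining_succ G θ hi] at h
      rw [augmented_succ G θ hi]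
      exact h.imp (fun h => ih h.1) id
    · rw [remaining, dif_neg hi] at h
      rw [augmented, dif_neg hi]
      exact ih h

theorem adj_plus {u w : V} (h : G.graph.Adj u w) : (G.plus θ).graph.Adj u w :=
  G.adj_augmented_mono θ (Nat.zero_le _) h

/-- If `u`--`v`--`w` is the unique shortest path and `v` is contracted before `u` and `w`, then
`u`--`w` is an edge of the augmented graph. -/
theorem adj_plus_of_unique {u v w : V} (huw : u ≠ w) (huv : G.graph.Adj u v)
    (hvw : G.graph.Adj v w) (hu : θ.symm v < θ.symm u) (hw : θ.symm v < θ.symm w)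
    (hz : ∀ z, z ≠ u → z ≠ v → z ≠ w →
      ((G.len u v + G.len v w : ℝ≥0) : ℝ≥0∞) < G.dist u z + G.dist z w) :
    (G.plus θ).graph.Adj u w := by
  classical
  set i : ℕ := (θ.symm v : ℕ) with hi
  have hic : i < Fintype.card V := (θ.symm v).2
  have hv : θ ⟨i, hic⟩ = v := by simp [hi]
  set R := G.remaining θ i with hR
  -- If `u` and `w` are not already adjacent, every walk from `u` to `w` that avoids `v` starts with
  -- a step to a third vertex `z`.
  by_cases hadj : R.graph.Adj u w
  · exact G.adj_augmented_mono θ hic.le (G.adj_augmented_of_adj_remaining θ i hadj)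
  obtain ⟨h1, h1'⟩ := G.adj_remaining θ huv i hu.le le_rfl
  obtain ⟨h2, h2'⟩ := G.adj_remaining θ hvw i le_rfl hw.le
  have hneed : R.NeedsShortcut v u w := by
    refine ⟨huw, h1, h2, ?_⟩
    have hle : ((R.len u v + R.len v w : ℝ≥0) : ℝ≥0∞) ≤ (G.len u v + G.len v w : ℝ≥0) :=
      ENNReal.coe_le_coe.2 (add_le_add h1' h2')
    refine hle.trans_lt ?_
    -- A strict bound for each walk does not by itself bound the infimum strictly; a minimum over
    -- the finitely many possible second vertices `z` does.
    let S : Finset V := Finset.univ.filter fun z => z ≠ u ∧ z ≠ v ∧ z ≠ w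
    have hS : ((G.len u v + G.len v w : ℝ≥0) : ℝ≥0∞) < S.inf fun z => G.dist u z + G.dist z w := by
      rw [Finset.lt_inf_iff ENNReal.coe_lt_top]
      intro z hzS
      simp only [S, Finset.mem_filter] at hzS
      exact hz z hzS.2.1 hzS.2.2.1 hzS.2.2.2
    refine hS.trans_le (le_iInf fun p => ?_)
    cases p with
    | nil => exact absurd rfl huw
    | @cons _ z _ h p =>
      have hzS : z ∈ S := by
        simp only [S, Finset.mem_filter, Finset.mem_univ, true_and]
        refine ⟨fun h' => h.1.ne h'.symm, h.2.2, ?_⟩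
        rintro rfl
        exact hadj h.1
      refine (Finset.inf_le hzS).trans ?_
      rw [walkLen_cons, ENNReal.coe_add]
      refine add_le_add (G.dist_le_len_remaining θ i _ _ h.1) ?_
      refine potential_le_walkLen _ G.dist G.dist_self (fun x y z hxy => ?_) p
      exact (G.dist_triangle x y z).trans
        (add_le_add (G.dist_le_len_remaining θ i _ _ hxy.1) le_rfl)
  have : (G.augmented θ (i + 1)).graph.Adj u w := by
    rw [augmented_succ G θ hic, hv]
    exact Or.inr hneed
  exact G.adj_augmented_mono θ hic this

end Shortcuts

/-! ### Lower bounds for the steps of a search. -/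

section Search

variable {V : Type} [Fintype V] (G : LenGraph V) (θ : Ordering V)

theorem mem_upward {v w : V} :
    w ∈ G.upward θ v ↔ (G.plus θ).graph.Adj v w ∧ θ.symm v < θ.symm w := by
  simp [upward]

open Classical in
/-- A search settles every vertex that is reachable by upward edges. -/
theorem sum_upward_le_searchSteps (s : V) (R : Finset V)
    (hR : ∀ x ∈ R, Relation.ReflTransGen (fun v w => w ∈ G.upward θ v) s x) (fuel : ℕ)
    (S : SearchState V) (hs : S.label s ≠ ⊤)
    (hup : ∀ v ∈ S.settled, ∀ w ∈ G.upward θ v, S.label w ≠ ⊤)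
    (hfuel : (S.settledᶜ).card ≤ fuel) :
    ∑ x ∈ R \ S.settled, (G.upward θ x).card ≤ G.searchSteps θ fuel S := by
  induction fuel generalizing S with
  | zero =>
    have : S.settled = Finset.univ := by
      rw [← Finset.compl_eq_empty_iff]
      exact Finset.card_eq_zero.1 (Nat.le_zero.1 hfuel)
    have hRS : R \ S.settled = ∅ := by
      ext x
      simp [this]
    rw [hRS]
    simp
  | succ fuel ih =>
    by_cases hq : S.queue.Nonempty
    · rw [searchSteps, dif_pos hq]
      dsimp only
      have hv := (Finset.exists_min_image S.queue S.label hq).choose_spec.1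
      set v := (Finset.exists_min_image S.queue S.label hq).choose
      simp only [SearchState.queue, Finset.mem_filter, Finset.mem_univ, true_and] at hv
      have hmono : ∀ w, S.label w ≠ ⊤ → (G.settle θ S v).label w ≠ ⊤ := by
        intro w hw
        simp only [settle]
        split_ifs
        · exact ne_top_of_le_ne_top hw (min_le_left _ _)
        · exact hw
      have key := ih (G.settle θ S v) (hmono s hs) (by
          intro x hx w hw
          simp only [settle, Finset.mem_insert] at hx
          rcases hx with rfl | hx
          · simp only [settle, if_pos hw]
            exact ne_top_of_le_ne_top (ENNReal.add_ne_top.2 ⟨hv.2, ENNReal.coe_ne_top⟩)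
              (min_le_right _ _)
          · exact hmono w (hup x hx w hw)) (by
          simp only [settle, Finset.compl_insert]
          rw [Finset.card_erase_of_mem (by simpa using hv.1)]
          omega)
      refine le_trans ?_ (Nat.add_le_add_left key _)
      have hsub : R \ S.settled ⊆ insert v (R \ (G.settle θ S v).settled) := by
        intro x hx
        simp only [settle, Finset.mem_sdiff, Finset.mem_insert] at hx ⊢
        tauto
      refine (Finset.sum_le_sum_of_subset hsub).trans ?_
      rw [Finset.sum_insert (by simp [settle])]
      omega
    -- With an empty queue, the settled set contains `s` and is closed under upward edges, hence
    -- contains `R`.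
    · have hall : ∀ x, S.label x ≠ ⊤ → x ∈ S.settled := by
        intro x hx
        by_contra hxs
        exact hq ⟨x, by simp [SearchState.queue, hx, hxs]⟩
      have hRS : R \ S.settled = ∅ := by
        rw [Finset.sdiff_eq_empty_iff_subset]
        intro x hx
        refine hall x ?_
        have := hR x hx
        clear hx
        induction this with
        | refl => exact hs
        | tail _ hbc ih' => exact hup _ (hall _ ih') _ hbc
      rw [hRS]
      simp

/-- The number of steps of a search from `s`. -/
noncomputable def searchTime (s : V) : ℕ :=
  G.searchSteps θ (Fintype.card V) (SearchState.init s)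

theorem sum_upward_le_searchTime (s : V) (R : Finset V)
    (hR : ∀ x ∈ R, Relation.ReflTransGen (fun v w => w ∈ G.upward θ v) s x) :
    ∑ x ∈ R, (G.upward θ x).card ≤ G.searchTime θ s := by
  classical
  have := G.sum_upward_le_searchSteps θ s R hR (Fintype.card V) (SearchState.init s)
    (by simp [SearchState.init]) (by simp [SearchState.init]) (Finset.card_le_univ _)
  have hE : (SearchState.init s).settled = ∅ := rfl
  rwa [hE, Finset.sdiff_empty] at this

theorem avgQueryTime_eq [Nonempty V] :
    G.avgQueryTime θ = 2 * (∑ s : V, (G.searchTime θ s : ℝ)) / Fintype.card V := by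
  have hc : (Fintype.card V : ℝ) ≠ 0 := by exact_mod_cast Fintype.card_ne_zero
  have : ∀ s t, (G.queryTime θ s t : ℝ) = G.searchTime θ s + G.searchTime θ t := by
    intro s t
    simp [queryTime, searchTime]
  simp only [avgQueryTime, this, Finset.sum_add_distrib, Finset.sum_const, Finset.card_univ,
    nsmul_eq_mul, ← Finset.mul_sum]
  field_simp
  ring

end Search

end LenGraph

/-! ### The tree metric and uniqueness of its shortest paths. -/

namespace TreeNode

variable {t k : ℕ}

/-- The ancestor of `x` of depth `m`. -/
def take (x : TreeNode t k) (m : ℕ) (hm : m ≤ (x.1 : ℕ)) : TreeNode t k :=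
  ⟨⟨m, lt_of_le_of_lt hm x.1.2⟩, fun i => x.2 (Fin.castLE hm i)⟩

/-- The first `m` choices that lead to `x` and `y` exist and agree. -/
def Agree (x y : TreeNode t k) (m : ℕ) : Prop :=
  ∃ (hx : m ≤ (x.1 : ℕ)) (hy : m ≤ (y.1 : ℕ)),
    ∀ i : Fin m, x.2 (Fin.castLE hx i) = y.2 (Fin.castLE hy i)

theorem Agree.symm {x y : TreeNode t k} {m : ℕ} (h : Agree x y m) : Agree y x m := by
  obtain ⟨hx, hy, h⟩ := h
  exact ⟨hy, hx, fun i => (h i).symm⟩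

theorem Agree.trans {x y z : TreeNode t k} {m : ℕ} (h : Agree x y m) (h' : Agree y z m) :
    Agree x z m := by
  obtain ⟨hx, hy, h⟩ := h
  obtain ⟨_, hz, h'⟩ := h'
  exact ⟨hx, hz, fun i => (h i).trans (h' i)⟩

theorem Agree.mono {x y : TreeNode t k} {m m' : ℕ} (h : Agree x y m) (hm : m' ≤ m) :
    Agree x y m' := by
  obtain ⟨hx, hy, h⟩ := h
  exact ⟨hm.trans hx, hm.trans hy, fun i => h (Fin.castLE hm i)⟩

theorem agree_self (x : TreeNode t k) : Agree x x x.1 := ⟨le_rfl, le_rfl, fun _ => rfl⟩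

theorem agree_zero (x y : TreeNode t k) : Agree x y 0 :=
  ⟨Nat.zero_le _, Nat.zero_le _, fun i => i.elim0⟩

theorem agree_take (x : TreeNode t k) (m : ℕ) (hm : m ≤ (x.1 : ℕ)) : Agree x (x.take m hm) m :=
  ⟨hm, le_rfl, fun _ => rfl⟩

theorem eq_of_agree {x y : TreeNode t k} (hxy : (x.1 : ℕ) = y.1) (h : Agree x y x.1) : x = y := by
  obtain ⟨dx, fx⟩ := x
  obtain ⟨dy, fy⟩ := y
  have : dx = dy := Fin.ext hxy
  subst this
  obtain ⟨_, _, h⟩ := h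
  congr 1
  funext i
  exact h i

open Classical in
/-- The depth of the lowest common ancestor. -/
noncomputable def commonDepth (x y : TreeNode t k) : ℕ := Nat.findGreatest (Agree x y) k

theorem agree_commonDepth (x y : TreeNode t k) : Agree x y (commonDepth x y) := by
  classical
  exact Nat.findGreatest_spec (P := Agree x y) (Nat.zero_le k) (agree_zero x y)

theorem agree_iff {x y : TreeNode t k} {m : ℕ} : Agree x y m ↔ m ≤ commonDepth x y := by
  classical
  refine ⟨fun h => Nat.le_findGreatest ?_ h, fun h => (agree_commonDepth x y).mono h⟩
  obtain ⟨hx, -⟩ := h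
  have := x.1.2
  omega

/-- The height of the lowest common ancestor. -/
noncomputable def lcaHeight (x y : TreeNode t k) : ℕ := k - commonDepth x y

theorem commonDepth_le (x y : TreeNode t k) : commonDepth x y ≤ x.1 :=
  (agree_commonDepth x y).1

theorem commonDepth_le' (x y : TreeNode t k) : commonDepth x y ≤ y.1 :=
  (agree_commonDepth x y).2.1

theorem depth_le (x : TreeNode t k) : (x.1 : ℕ) ≤ k := Nat.lt_succ_iff.1 x.1.2

theorem height_le (x : TreeNode t k) : x.height ≤ k := Nat.sub_le _ _

theorem lcaHeight_le (x y : TreeNode t k) : lcaHeight x y ≤ k := Nat.sub_le _ _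

theorem commonDepth_comm (x y : TreeNode t k) : commonDepth x y = commonDepth y x :=
  le_antisymm (agree_iff.1 (agree_commonDepth x y).symm) (agree_iff.1 (agree_commonDepth y x).symm)

theorem lcaHeight_comm (x y : TreeNode t k) : lcaHeight x y = lcaHeight y x := by
  rw [lcaHeight, commonDepth_comm, lcaHeight]

theorem commonDepth_self (x : TreeNode t k) : commonDepth x x = x.1 :=
  le_antisymm (commonDepth_le x x) (agree_iff.1 (agree_self x))

@[simp] theorem lcaHeight_self (x : TreeNode t k) : lcaHeight x x = x.height := by
  rw [lcaHeight, commonDepth_self, height]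

theorem height_le_lcaHeight (x y : TreeNode t k) : x.height ≤ lcaHeight x y :=
  Nat.sub_le_sub_left (commonDepth_le x y) k

theorem height_le_lcaHeight' (x y : TreeNode t k) : y.height ≤ lcaHeight x y :=
  Nat.sub_le_sub_left (commonDepth_le' x y) k

theorem lcaHeight_ultra (x y z : TreeNode t k) :
    lcaHeight x z ≤ max (lcaHeight x y) (lcaHeight y z) := by
  have h : min (commonDepth x y) (commonDepth y z) ≤ commonDepth x z :=
    agree_iff.1 (((agree_commonDepth x y).mono (min_le_left _ _)).trans
      ((agree_commonDepth y z).mono (min_le_right _ _)))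
  unfold lcaHeight
  omega

theorem eq_of_lcaHeight {x y : TreeNode t k} (hx : x.height = lcaHeight x y)
    (hy : y.height = lcaHeight x y) : x = y := by
  have h1 := commonDepth_le x y
  have h2 := commonDepth_le' x y
  have h3 := depth_le x
  have h4 := depth_le y
  unfold height lcaHeight at hx hy
  refine eq_of_agree (by omega) (agree_iff.2 (by omega))

/-- Expresses ancestry through heights, so that later arguments reduce to linear arithmetic and the
ultrametric inequality. -/
theorem properAncestor_iff {w v : TreeNode t k} :
    ProperAncestor w v ↔ v.height < w.height ∧ lcaHeight w v = w.height := by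
  have h1 := commonDepth_le w v
  have h3 := depth_le w
  have h4 := depth_le v
  unfold height lcaHeight
  constructor
  · rintro ⟨h, h'⟩
    have : (w.1 : ℕ) ≤ commonDepth w v := agree_iff.1 ⟨le_rfl, h.le, fun i => (h' i).symm⟩
    omega
  · rintro ⟨h, h'⟩
    have : Agree w v w.1 := agree_iff.2 (by omega)
    obtain ⟨_, _, h2⟩ := this
    exact ⟨by omega, fun i => (h2 i).symm⟩

theorem height_take (x : TreeNode t k) (m : ℕ) (hm : m ≤ (x.1 : ℕ)) :
    (x.take m hm).height = k - m := rfl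

theorem exists_lca (x y : TreeNode t k) :
    ∃ u : TreeNode t k, u.height = lcaHeight x y ∧ lcaHeight x u = u.height ∧
      lcaHeight u y = u.height := by
  have h := agree_commonDepth x y
  have hx := commonDepth_le x y
  have h1 := agree_take x _ hx
  refine ⟨x.take (commonDepth x y) hx, rfl, le_antisymm ?_ (height_le_lcaHeight' _ _),
    le_antisymm ?_ (height_le_lcaHeight _ _)⟩
  · exact Nat.sub_le_sub_left (agree_iff.1 h1) k
  · exact Nat.sub_le_sub_left (agree_iff.1 (h1.symm.trans h)) k

/-- The length of the edge from a node of height `a` to an ancestor of height `s`, or `0`. -/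
def climb (a s : ℕ) : ℕ := if a < s then 16 ^ (s - 1) else 0

theorem climb_self (a : ℕ) : climb a a = 0 := if_neg (lt_irrefl a)

theorem climb_le (a s : ℕ) : climb a s ≤ 16 ^ (s - 1) := by
  unfold climb
  split_ifs <;> simp

theorem climb_of_lt {a s : ℕ} (h : a < s) : climb a s = 16 ^ (s - 1) := if_pos h

theorem climb_pos {a s : ℕ} (h : a < s) : 1 ≤ climb a s := by
  rw [climb_of_lt h]
  exact Nat.one_le_pow _ _ (by norm_num)

theorem climb_lt {a s s' : ℕ} (has : a ≤ s) (h : s < s') : climb a s < climb a s' := by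
  rw [climb_of_lt (has.trans_lt h)]
  by_cases h' : a < s
  · rw [climb_of_lt h']
    exact Nat.pow_lt_pow_right (by norm_num) (by omega)
  · simp [climb, h']

/-- The distance of two nodes within one copy of the tree. -/
noncomputable def treeDist (x y : TreeNode t k) : ℕ :=
  climb x.height (lcaHeight x y) + climb y.height (lcaHeight x y)

theorem treeDist_comm (x y : TreeNode t k) : treeDist x y = treeDist y x := by
  rw [treeDist, treeDist, lcaHeight_comm, add_comm]

@[simp] theorem treeDist_self (x : TreeNode t k) : treeDist x x = 0 := by
  simp [treeDist, climb_self]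

theorem treeDist_pos {x y : TreeNode t k} (h : x ≠ y) : 1 ≤ treeDist x y := by
  by_cases hx : x.height < lcaHeight x y
  · exact le_add_right (climb_pos hx)
  · by_cases hy : y.height < lcaHeight x y
    · exact le_add_left (climb_pos hy)
    · exact absurd (eq_of_lcaHeight (le_antisymm (height_le_lcaHeight _ _) (not_lt.1 hx))
        (le_antisymm (height_le_lcaHeight' _ _) (not_lt.1 hy))) h

/-- `u` is the lowest common ancestor of `x` and `y`. -/
def IsLca (u x y : TreeNode t k) : Prop :=
  u.height = lcaHeight x y ∧ lcaHeight x u = u.height ∧ lcaHeight u y = u.height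

theorem IsLca.unique {u v x y : TreeNode t k} (hu : IsLca u x y) (hv : IsLca v x y) : u = v := by
  have h1 := lcaHeight_ultra u x v
  rw [lcaHeight_comm u x, hu.2.1, hv.2.1, hu.1, hv.1, max_self] at h1
  have h2 := height_le_lcaHeight u v
  have h3 := height_le_lcaHeight' u v
  have := hu.1
  have := hv.1
  exact eq_of_lcaHeight (by omega) (by omega)

theorem IsLca.treeDist {u x y : TreeNode t k} (h : IsLca u x y) :
    treeDist x y = treeDist x u + treeDist u y := by
  obtain ⟨h1, h2, h3⟩ := h
  unfold TreeNode.treeDist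
  rw [h2, h3, ← h1, climb_self]
  omega

theorem IsLca.symm {u x y : TreeNode t k} (h : IsLca u x y) : IsLca u y x :=
  ⟨by rw [h.1, lcaHeight_comm], by rw [lcaHeight_comm, h.2.2], by rw [lcaHeight_comm, h.2.1]⟩

/-- By the ultrametric inequality the two largest of the three `lcaHeight`s coincide. If `z`
branches off towards `x` strictly below the top, its climb to the top costs at least that of `x`,
and `x`–`z` comes in addition. If `z` branches off above the meeting point of `x` and `y`, both
climbs get longer. If all three heights agree, `z` pays for a climb and a descent unless it is the
common ancestor itself. -/
theorem treeDist_lt_of_le {x y z : TreeNode t k} (hx : z ≠ x) (hz : ¬ IsLca z x y)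
    (h : lcaHeight x z ≤ lcaHeight z y) : treeDist x y < treeDist x z + treeDist z y := by
  have hu1 := lcaHeight_ultra x z y
  have hu2 := lcaHeight_ultra z x y
  rw [lcaHeight_comm z x] at hu2
  have hzx := height_le_lcaHeight' x z
  have hpos := treeDist_pos hx.symm
  rcases h.lt_or_eq with h | h
  · have hp : lcaHeight x y = lcaHeight z y := by omega
    have := climb_le x.height (lcaHeight z y)
    have : climb z.height (lcaHeight z y) = _ := climb_of_lt (by omega)
    unfold treeDist at *
    rw [hp]
    omega
  · have hp : lcaHeight x y ≤ lcaHeight z y := by omega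
    rcases hp.lt_or_eq with hp | hp
    · have h1 := climb_lt (height_le_lcaHeight x y) hp
      have h2 := climb_lt (height_le_lcaHeight' x y) hp
      unfold treeDist
      rw [h]
      omega
    · have hlt : z.height < lcaHeight z y := by
        by_contra hcon
        have := height_le_lcaHeight z y
        exact hz ⟨by omega, by omega, by omega⟩
      have := climb_pos hlt
      unfold treeDist
      rw [h, hp]
      omega

/-- Shortest paths within one copy of the tree are unique. -/
theorem treeDist_lt {x y z : TreeNode t k} (hx : z ≠ x) (hy : z ≠ y) (hz : ¬ IsLca z x y) :
    treeDist x y < treeDist x z + treeDist z y := by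
  rcases le_total (lcaHeight x z) (lcaHeight z y) with h | h
  · exact treeDist_lt_of_le hx hz h
  · rw [treeDist_comm x y, treeDist_comm x z, treeDist_comm z y, add_comm]
    refine treeDist_lt_of_le hy (fun h' => hz h'.symm) ?_
    rwa [lcaHeight_comm y z, lcaHeight_comm z x]

theorem treeDist_triangle (x z y : TreeNode t k) :
    treeDist x y ≤ treeDist x z + treeDist z y := by
  by_cases hx : z = x
  · simp [hx]
  by_cases hy : z = y
  · simp [hy]
  by_cases hz : IsLca z x y
  · exact hz.treeDist.le
  · exact (treeDist_lt hx hy hz).le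

end TreeNode

/-! ### Distances between the copies of the tree. -/

namespace LenGraph

open TreeNode

variable {t k q : ℕ}

/-- Distances in `treeCopiesGraph t k q` in units of `2 ^ (-k-1)`. -/
noncomputable def copyDist (X Y : TreeNode t k × Fin q) : ℕ :=
  2 ^ (k + 1) * treeDist X.1 Y.1 + if X.2 = Y.2 then 0 else 2 ^ min X.1.height Y.1.height

theorem copyDist_of_eq {X Y : TreeNode t k × Fin q} (h : X.2 = Y.2) :
    copyDist X Y = 2 ^ (k + 1) * treeDist X.1 Y.1 := by
  rw [copyDist, if_pos h, add_zero]

theorem copyDist_of_ne {X Y : TreeNode t k × Fin q} (h : X.2 ≠ Y.2) :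
    copyDist X Y = 2 ^ (k + 1) * treeDist X.1 Y.1 + 2 ^ min X.1.height Y.1.height := by
  rw [copyDist, if_neg h]

theorem copyDist_same (x y : TreeNode t k) (a : Fin q) :
    copyDist (x, a) (y, a) = 2 ^ (k + 1) * treeDist x y := copyDist_of_eq rfl

theorem copyDist_comm (X Y : TreeNode t k × Fin q) : copyDist X Y = copyDist Y X := by
  unfold copyDist
  rw [treeDist_comm, min_comm]
  simp only [eq_comm]

@[simp] theorem copyDist_self (X : TreeNode t k × Fin q) : copyDist X X = 0 := by
  simp [copyDist]

theorem mul_treeDist_le_copyDist (X Y : TreeNode t k × Fin q) :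
    2 ^ (k + 1) * treeDist X.1 Y.1 ≤ copyDist X Y := Nat.le_add_right _ _

theorem two_mul_two_pow_le {a : ℕ} (h : a ≤ k) : 2 * 2 ^ a ≤ 2 ^ (k + 1) := by
  rw [pow_succ, mul_comm]
  exact Nat.mul_le_mul_right _ (Nat.pow_le_pow_right (by norm_num) h)

theorem copyDist_le (X Y : TreeNode t k × Fin q) :
    copyDist X Y ≤ 2 ^ (k + 1) * treeDist X.1 Y.1 + 2 ^ min X.1.height Y.1.height := by
  unfold copyDist
  split_ifs <;> simp

/-- Tree distances are integers, so a strict inequality gains a whole unit `2 ^ (k + 1)`, which pays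
for two changes of copy at `x`. -/
theorem treeDist_step {x y z : TreeNode t k} (h : treeDist x y < treeDist x z + treeDist z y) :
    2 ^ (k + 1) * treeDist x y + 2 * 2 ^ x.height ≤
      2 ^ (k + 1) * treeDist x z + 2 ^ (k + 1) * treeDist z y := by
  have h1 := Nat.mul_le_mul_left (2 ^ (k + 1)) h
  rw [Nat.succ_eq_add_one, mul_add, mul_add, mul_one] at h1
  have h2 := two_mul_two_pow_le (height_le x)
  omega

/-- A strict tree inequality leaves enough slack for the change of copy. Otherwise `z` is an
endpoint or the common ancestor, so it is at least as high as `x` or `y`, and changing copy via `z`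
is no cheaper. -/
theorem copyDist_triangle (X Z Y : TreeNode t k × Fin q) :
    copyDist X Y ≤ copyDist X Z + copyDist Z Y := by
  have hT := Nat.mul_le_mul_left (2 ^ (k + 1)) (treeDist_triangle X.1 Z.1 Y.1)
  rw [mul_add] at hT
  have hXZ := mul_treeDist_le_copyDist X Z
  have hZY := mul_treeDist_le_copyDist Z Y
  by_cases hXY : X.2 = Y.2
  · rw [copyDist_of_eq hXY]
    omega
  have hmin : 2 ^ min X.1.height Y.1.height ≤ 2 ^ X.1.height :=
    Nat.pow_le_pow_right (by norm_num) (min_le_left _ _)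
  have hpos : 0 < 2 ^ X.1.height := by positivity
  by_cases hs : treeDist X.1 Y.1 < treeDist X.1 Z.1 + treeDist Z.1 Y.1
  · have := treeDist_step hs
    rw [copyDist_of_ne hXY]
    omega
  have hcase : X.1.height ≤ Z.1.height ∨ Y.1.height ≤ Z.1.height := by
    by_cases hx : Z.1 = X.1
    · exact Or.inl (by rw [hx])
    by_cases hy : Z.1 = Y.1
    · exact Or.inr (by rw [hy])
    by_cases hz : IsLca Z.1 X.1 Y.1
    · left
      rw [hz.1]
      exact height_le_lcaHeight _ _
    · exact absurd (treeDist_lt hx hy hz) hs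
  rw [copyDist_of_ne hXY]
  by_cases hXZ' : X.2 = Z.2
  · have hZY' : Z.2 ≠ Y.2 := fun h => hXY (hXZ'.trans h)
    have : 2 ^ min X.1.height Y.1.height ≤ 2 ^ min Z.1.height Y.1.height :=
      Nat.pow_le_pow_right (by norm_num) (by omega)
    rw [copyDist_of_ne hZY']
    omega
  · by_cases hZY' : Z.2 = Y.2
    · have : 2 ^ min X.1.height Y.1.height ≤ 2 ^ min X.1.height Z.1.height :=
        Nat.pow_le_pow_right (by norm_num) (by omega)
      rw [copyDist_of_ne hXZ']
      omega
    · rw [copyDist_of_ne hXZ', copyDist_of_ne hZY']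
      have : 2 ^ min X.1.height Y.1.height ≤
          2 ^ min X.1.height Z.1.height + 2 ^ min Z.1.height Y.1.height := by
        rcases hcase with h | h
        · exact le_add_right (Nat.pow_le_pow_right (by norm_num) (by omega))
        · exact le_add_left (Nat.pow_le_pow_right (by norm_num) (by omega))
      omega

theorem adj_iff {X Y : TreeNode t k × Fin q} : (treeCopiesGraph t k q).graph.Adj X Y ↔
    (X.2 = Y.2 ∧ X.1 ≠ Y.1 ∧ lcaHeight X.1 Y.1 = max X.1.height Y.1.height) ∨
      (X.1 = Y.1 ∧ X.2 ≠ Y.2) := by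
  refine or_congr (and_congr_right fun _ => ?_) Iff.rfl
  rw [properAncestor_iff, properAncestor_iff, lcaHeight_comm Y.1]
  have h1 := height_le_lcaHeight X.1 Y.1
  have h2 := height_le_lcaHeight' X.1 Y.1
  constructor
  · rintro (h | h)
    · exact ⟨fun h' => by rw [h'] at h; omega, by omega⟩
    · exact ⟨fun h' => by rw [h'] at h; omega, by omega⟩
  · rintro ⟨h, h'⟩
    rcases lt_trichotomy X.1.height Y.1.height with h3 | h3 | h3
    · right; omega
    · exact absurd (eq_of_lcaHeight (by omega) (by omega)) h
    · left; omega

theorem lcaHeight_of_adj {X Y : TreeNode t k × Fin q}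
    (h : (treeCopiesGraph t k q).graph.Adj X Y) :
    lcaHeight X.1 Y.1 = max X.1.height Y.1.height := by
  rcases adj_iff.1 h with h | h
  · exact h.2.2
  · rw [h.1, lcaHeight_self, max_self]

theorem treeDist_of_lcaHeight {x y : TreeNode t k} (hne : x ≠ y)
    (h : lcaHeight x y = max x.height y.height) :
    treeDist x y = 16 ^ (max x.height y.height - 1) := by
  unfold treeDist climb
  rw [h]
  rcases lt_trichotomy x.height y.height with h3 | h3 | h3
  · rw [if_pos (by omega), if_neg (by omega), add_zero]
  · exact absurd (eq_of_lcaHeight (by omega) (by omega)) hne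
  · rw [if_neg (by omega), if_pos (by omega), zero_add]

variable (m : ℝ≥0)

theorem len_scale_of_adj {X Y : TreeNode t k × Fin q}
    (h : (treeCopiesGraph t k q).graph.Adj X Y) :
    ((treeCopiesGraph t k q).scale m).len X Y = m / 2 ^ (k + 1) * copyDist X Y := by
  have h2 : (2 : ℝ≥0) ^ (k + 1) ≠ 0 := by positivity
  show m * (if X.2 = Y.2 then _ else _) = _
  rcases adj_iff.1 h with ⟨h1, hne, hl⟩ | ⟨h1, hne⟩
  · rw [if_pos h1, copyDist_of_eq h1, treeDist_of_lcaHeight hne hl]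
    push_cast
    field_simp
  · rw [if_neg hne, copyDist_of_ne hne, h1, treeDist_self, max_self, min_self]
    push_cast
    field_simp
    simp

theorem adj_tree {x y : TreeNode t k} (hne : x ≠ y) (h : lcaHeight x y = y.height) (a : Fin q) :
    (treeCopiesGraph t k q).graph.Adj (x, a) (y, a) := by
  refine adj_iff.2 (Or.inl ⟨rfl, hne, ?_⟩)
  have := height_le_lcaHeight x y
  simp only
  omega

theorem adj_copy (x : TreeNode t k) {a b : Fin q} (h : a ≠ b) :
    (treeCopiesGraph t k q).graph.Adj (x, a) (x, b) :=
  adj_iff.2 (Or.inr ⟨rfl, h⟩)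

theorem dist_scale_le_of_adj {X Y : TreeNode t k × Fin q}
    (h : (treeCopiesGraph t k q).graph.Adj X Y) :
    ((treeCopiesGraph t k q).scale m).dist X Y ≤ (m / 2 ^ (k + 1) * copyDist X Y : ℝ≥0) := by
  rw [← len_scale_of_adj m h]
  exact dist_le_len _ h

theorem dist_scale_le_of_le {X Y Z : TreeNode t k × Fin q}
    (h : copyDist X Z + copyDist Z Y ≤ copyDist X Y)
    (h1 : ((treeCopiesGraph t k q).scale m).dist X Z ≤ (m / 2 ^ (k + 1) * copyDist X Z : ℝ≥0))
    (h2 : ((treeCopiesGraph t k q).scale m).dist Z Y ≤ (m / 2 ^ (k + 1) * copyDist Z Y : ℝ≥0)) :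
    ((treeCopiesGraph t k q).scale m).dist X Y ≤ (m / 2 ^ (k + 1) * copyDist X Y : ℝ≥0) := by
  refine (dist_triangle _ X Z Y).trans ((add_le_add h1 h2).trans ?_)
  rw [← ENNReal.coe_add, ENNReal.coe_le_coe, ← mul_add]
  exact mul_le_mul_right (by exact_mod_cast h) _

theorem dist_scale_ancestor_le {x y : TreeNode t k} (h : lcaHeight x y = y.height) (a : Fin q) :
    ((treeCopiesGraph t k q).scale m).dist (x, a) (y, a) ≤
      (m / 2 ^ (k + 1) * copyDist (x, a) (y, a) : ℝ≥0) := by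
  by_cases hne : x = y
  · simp [hne]
  · exact dist_scale_le_of_adj m (adj_tree hne h a)

theorem dist_scale_copy_le (x : TreeNode t k) (a b : Fin q) :
    ((treeCopiesGraph t k q).scale m).dist (x, a) (x, b) ≤
      (m / 2 ^ (k + 1) * copyDist (x, a) (x, b) : ℝ≥0) := by
  by_cases hne : a = b
  · simp [hne]
  · exact dist_scale_le_of_adj m (adj_copy x hne)

theorem dist_scale_same_le (x y : TreeNode t k) (a : Fin q) :
    ((treeCopiesGraph t k q).scale m).dist (x, a) (y, a) ≤
      (m / 2 ^ (k + 1) * copyDist (x, a) (y, a) : ℝ≥0) := by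
  obtain ⟨u, hu⟩ := exists_lca x y
  have hu' : IsLca u x y := hu
  refine dist_scale_le_of_le m (Z := (u, a)) ?_ (dist_scale_ancestor_le m hu'.2.1 a) ?_
  · rw [copyDist_same, copyDist_same, copyDist_same, ← mul_add, ← hu'.treeDist]
  · rw [dist_comm, copyDist_comm]
    exact dist_scale_ancestor_le m hu'.symm.2.1 a

/-- The copy is changed at the lower node, before climbing. -/
theorem dist_scale_le_of_height_le {x y : TreeNode t k} (h : x.height ≤ y.height) (a b : Fin q) :
    ((treeCopiesGraph t k q).scale m).dist (x, a) (y, b) ≤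
      (m / 2 ^ (k + 1) * copyDist (x, a) (y, b) : ℝ≥0) := by
  by_cases hab : a = b
  · rw [hab]
    exact dist_scale_same_le m x y b
  refine dist_scale_le_of_le m (Z := (x, b)) ?_ (dist_scale_copy_le m x a b)
    (dist_scale_same_le m x y b)
  rw [copyDist_of_ne (X := (x, a)) (Y := (x, b)) hab, copyDist_of_ne (X := (x, a)) (Y := (y, b)) hab,
    copyDist_same]
  simp only [treeDist_self, min_self, min_eq_left h]
  omega

/-- Explicit paths give the upper bound. For the lower bound, `copyDist` is exact on edges and
satisfies the triangle inequality, so it is a potential. -/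
theorem dist_scale (X Y : TreeNode t k × Fin q) :
    ((treeCopiesGraph t k q).scale m).dist X Y = (m / 2 ^ (k + 1) * copyDist X Y : ℝ≥0) := by
  refine le_antisymm ?_ ?_
  · rcases le_total X.1.height Y.1.height with h | h
    · exact dist_scale_le_of_height_le m h X.2 Y.2
    · rw [dist_comm, copyDist_comm]
      exact dist_scale_le_of_height_le m h Y.2 X.2
  · refine potential_le_dist _
      (fun X Y => ((m / 2 ^ (k + 1) * copyDist X Y : ℝ≥0) : ℝ≥0∞)) (by simp) ?_ X Y
    intro X Y Z h
    rw [len_scale_of_adj m h, ← ENNReal.coe_add, ENNReal.coe_le_coe, ← mul_add]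
    exact mul_le_mul_right (by exact_mod_cast copyDist_triangle X Y Z) _

theorem scale_one {V : Type} (G : LenGraph V) : G.scale 1 = G := by
  cases G
  simp [scale]

/-! ### Highway dimension. -/

section Highway

/-- The common ancestor of two adjacent nodes is the higher one, so a walk cannot leave a subtree
without visiting an ancestor of its root. -/
theorem lcaHeight_lt_of_walk {X Y : TreeNode t k × Fin q} {l : ℕ}
    (p : ((treeCopiesGraph t k q).scale m).graph.Walk X Y)
    (h : ∀ z ∈ p.support, z.1.height < l) : lcaHeight X.1 Y.1 < l := by
  induction p with
  | nil => simpa using h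
  | @cons X Z Y hXZ p ih =>
    have h1 := ih fun z hz => h z (by simp [hz])
    have h2 := lcaHeight_of_adj hXZ
    have hX := h X (by simp)
    have hZ := h Z (by simp)
    have := lcaHeight_ultra X.1 Z.1 Y.1
    omega

theorem treeDist_le (x y : TreeNode t k) : treeDist x y ≤ 2 * 16 ^ (lcaHeight x y - 1) := by
  have h1 := climb_le x.height (lcaHeight x y)
  have h2 := climb_le y.height (lcaHeight x y)
  unfold treeDist
  omega

/-- For `j ≥ 1`, in units of `2 ^ (k + 1)`, the distance is at most `2 * 16 ^ (j - 1) + 1/2`, and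
four times this is less than `16 ^ j`. For `j = 0` the distance is at most one small unit, and `k ≥
2` is needed. -/
theorem four_mul_copyDist_lt {X Y : TreeNode t k × Fin q} {j : ℕ} (hk : 2 ≤ k)
    (h : lcaHeight X.1 Y.1 ≤ j) : 4 * copyDist X Y < 2 ^ (k + 1) * 16 ^ j := by
  have hc := copyDist_le X Y
  have h8 : 2 ^ 3 ≤ 2 ^ (k + 1) := Nat.pow_le_pow_right (by norm_num) (by omega)
  have hX := height_le_lcaHeight X.1 Y.1
  have hY := height_le_lcaHeight' X.1 Y.1
  rcases Nat.eq_zero_or_pos j with rfl | hj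
  · have : treeDist X.1 Y.1 = 0 := by
      unfold treeDist climb
      rw [if_neg (by omega), if_neg (by omega)]
    rw [this, show X.1.height = 0 by omega] at hc
    simp at hc
    omega
  · obtain ⟨i, rfl⟩ : ∃ i, j = i + 1 := ⟨j - 1, by omega⟩
    have h1 : treeDist X.1 Y.1 ≤ 2 * 16 ^ i :=
      (treeDist_le _ _).trans (Nat.mul_le_mul_left _ (Nat.pow_le_pow_right (by norm_num) (by omega)))
    have h2 : 2 * 2 ^ min X.1.height Y.1.height ≤ 2 ^ (k + 1) :=
      two_mul_two_pow_le ((min_le_left _ _).trans (height_le _))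
    have h3 : 1 ≤ 16 ^ i := Nat.one_le_pow _ _ (by norm_num)
    have h4 := Nat.mul_le_mul_left (2 ^ (k + 1)) h1
    have h5 := Nat.mul_le_mul_left (2 ^ (k + 1)) h3
    rw [pow_succ 16 i]
    generalize 2 ^ min X.1.height Y.1.height = e at *
    have h6 : 2 ^ (k + 1) * (2 * 16 ^ i) = 2 * (2 ^ (k + 1) * 16 ^ i) := by ring
    have h7 : 2 ^ (k + 1) * (16 ^ i * 16) = 16 * (2 ^ (k + 1) * 16 ^ i) := by ring
    omega

theorem treeDist_lt_of_copyDist_lt {X Y : TreeNode t k × Fin q} {j : ℕ}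
    (h : copyDist X Y < 2 ^ (k + 1) * 16 ^ j) : treeDist X.1 Y.1 < 16 ^ j :=
  lt_of_mul_lt_mul_left ((mul_treeDist_le_copyDist X Y).trans_lt h) (Nat.zero_le _)

theorem lcaHeight_le_of_copyDist_lt {X Y : TreeNode t k × Fin q} {j : ℕ}
    (h : copyDist X Y < 2 ^ (k + 1) * 16 ^ j) : lcaHeight X.1 Y.1 ≤ max X.1.height j := by
  have h2 := treeDist_lt_of_copyDist_lt h
  by_contra hcon
  have h3 : 16 ^ (lcaHeight X.1 Y.1 - 1) ≤ treeDist X.1 Y.1 := by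
    rw [treeDist, climb_of_lt (by omega : X.1.height < lcaHeight X.1 Y.1)]
    exact Nat.le_add_right _ _
  have h4 : 16 ^ j ≤ 16 ^ (lcaHeight X.1 Y.1 - 1) := Nat.pow_le_pow_right (by norm_num) (by omega)
  omega

variable {m}

theorem highwayBound_scale (hm : 0 < m) (hk : 2 ≤ k) :
    ((treeCopiesGraph t k q).scale m).HighwayBound q := by
  classical
  intro r hr v
  set κ : ℝ≥0 := m / 2 ^ (k + 1) with hκ
  have hκ0 : 0 < κ := by positivity
  -- the ball only sees heights up to `j`
  have hex : ∃ j : ℕ, 4 * r ≤ κ * (2 ^ (k + 1) * 16 ^ j) := by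
    obtain ⟨j, hj⟩ := pow_unbounded_of_one_lt (4 * r / κ) (by norm_num : (1 : ℝ≥0) < 16)
    refine ⟨j, ?_⟩
    rw [div_lt_iff₀ hκ0] at hj
    refine hj.le.trans ?_
    rw [mul_comm]
    refine mul_le_mul_right ?_ _
    exact le_mul_of_one_le_left (by positivity) (one_le_pow₀ (by norm_num))
  set j := Nat.find hex with hj
  have hj1 := Nat.find_spec hex
  rw [← hj] at hj1
  -- The covering node is the ancestor of `v` of height `j`, capped by the root, or `v` itself if
  -- `v` is higher already.
  set j' := max v.1.height (min j k)
  refine ⟨Finset.univ.filter fun x => x.1.height = j' ∧ lcaHeight v.1 x.1 ≤ j', ?_, ?_⟩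
  · have : Set.InjOn (Prod.snd : TreeNode t k × Fin q → Fin q)
        (Finset.univ.filter fun x : TreeNode t k × Fin q =>
          x.1.height = j' ∧ lcaHeight v.1 x.1 ≤ j') := by
      intro x hx y hy hxy
      simp only [Finset.coe_filter, Finset.mem_univ, true_and, Set.mem_ofPred_eq] at hx hy
      refine Prod.ext ?_ hxy
      have h1 := lcaHeight_ultra x.1 v.1 y.1
      rw [lcaHeight_comm x.1 v.1] at h1
      have h2 := height_le_lcaHeight x.1 y.1
      exact eq_of_lcaHeight (by omega) (by omega)
    simpa using Finset.card_le_card_of_injOn _ (fun x _ => Finset.mem_univ x.2) this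
  · intro x y p hp hlen hball
    have hcd : ∀ z ∈ p.support, copyDist v z < 2 ^ (k + 1) * 16 ^ j := by
      intro z hz
      have h1 := hball z hz
      rw [ball, Set.mem_ofPred_eq, dist_comm, dist_scale, ← hκ, ENNReal.coe_lt_coe] at h1
      have h2 : (copyDist v z : ℝ≥0) < 2 ^ (k + 1) * 16 ^ j :=
        lt_of_mul_lt_mul_left (h1.trans_le hj1) hκ0.le
      exact_mod_cast h2
    have hmu : ∀ z ∈ p.support, lcaHeight v.1 z.1 ≤ j' := by
      intro z hz
      have h3 := lcaHeight_le_of_copyDist_lt (hcd z hz)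
      have h4 := lcaHeight_le v.1 z.1
      omega
    by_contra hcon
    have hlt : ∀ z ∈ p.support, z.1.height < j' := by
      intro z hz
      have h1 := hmu z hz
      have h2 := height_le_lcaHeight' v.1 z.1
      refine lt_of_le_of_ne (h2.trans h1) fun h3 => hcon ⟨z, hz, ?_⟩
      simp [h3, h1]
    have hxy := lcaHeight_lt_of_walk m p hlt
    -- If `v` were higher than `j`, every vertex strictly lower than `v` would be at distance at
    -- least `16 ^ j` in the tree, outside the ball; so the path would have to use a copy of `v`.
    have hvlt : v.1.height ≤ min j k := by
      by_contra hvj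
      have h1 := hmu x p.start_mem_support
      have h2 := hlt x p.start_mem_support
      have h3 := height_le_lcaHeight v.1 x.1
      have hvk := height_le v.1
      have h4 : climb x.1.height (lcaHeight v.1 x.1) = _ := climb_of_lt (by omega)
      have h5 := treeDist_lt_of_copyDist_lt (hcd x p.start_mem_support)
      have h6 : 16 ^ j ≤ 16 ^ (lcaHeight v.1 x.1 - 1) :=
        Nat.pow_le_pow_right (by norm_num) (by omega)
      rw [treeDist, h4] at h5
      omega
    have hj0 : j - 1 < j := by omega
    -- A path confined below height `j` is too short: four times its length is less than the bound
    -- for `j - 1`, which by minimality of `j` is less than `4 * r`.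
    have hj2 := Nat.find_min hex hj0
    rw [not_le] at hj2
    have h5 := four_mul_copyDist_lt hk (show lcaHeight x.1 y.1 ≤ j - 1 by omega)
    have h6 := hp.2
    rw [dist_scale, ← hκ, ENNReal.coe_inj] at h6
    rw [h6] at hlen
    have h7 : κ * (4 * copyDist x y) < κ * (2 ^ (k + 1) * 16 ^ (j - 1)) :=
      mul_lt_mul_of_pos_left (by exact_mod_cast h5) hκ0
    have h8 : 4 * r ≤ κ * (4 * copyDist x y) := by
      calc 4 * r ≤ 4 * (κ * copyDist x y) := mul_le_mul_right hlen _
        _ = _ := by ring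
    exact absurd (hj2.trans_le h8) (not_lt.2 h7.le)

/-- Vertex-disjoint long shortest paths within one ball have to be covered separately. -/
theorem le_of_highwayBound_scale (hm : 0 < m) (ht : 2 ≤ t) (hk : 2 ≤ k) {h : ℕ}
    (hh : ((treeCopiesGraph t k q).scale m).HighwayBound h) : q ≤ h := by
  classical
  rcases Nat.eq_zero_or_pos q with rfl | hq
  · exact Nat.zero_le _
  let x : TreeNode t k := ⟨⟨1, by omega⟩, fun _ => ⟨0, by omega⟩⟩
  let y : TreeNode t k := x.take 0 (Nat.zero_le _)
  have hyx : y.height = k := rfl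
  have hxh : x.height = k - 1 := rfl
  have hxy : lcaHeight x y = y.height :=
    le_antisymm (lcaHeight_le _ _) (height_le_lcaHeight' _ _)
  have hne : x ≠ y := fun h => by
    rw [h, hyx] at hxh
    omega
  have hT : treeDist x y = 16 ^ (k - 1) := by
    rw [treeDist_of_lcaHeight hne (by rw [hxy]; omega)]
    congr 1
    omega
  set κ : ℝ≥0 := m / 2 ^ (k + 1) with hκ
  have hκ0 : 0 < κ := by positivity
  have hcd : ∀ a : Fin q, copyDist (x, a) (y, a) = 2 ^ (k + 1) * 16 ^ (k - 1) := fun a => by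
    rw [copyDist_same, hT]
  set L : ℕ := 2 ^ (k + 1) * 16 ^ (k - 1) with hL
  have hkL : 2 ^ k ≤ L := by
    have := two_mul_two_pow_le (le_refl k)
    have h3 : 2 ^ (k + 1) ≤ L := Nat.le_mul_of_pos_right _ (by positivity)
    omega
  have hL0 : 0 < L := by positivity
  -- The radius is the length of a root–child edge; all copies of this edge lie within twice that
  -- distance of one copy of the root.
  obtain ⟨H, hH, hcov⟩ := hh (κ * L) (by positivity) (y, ⟨0, hq⟩)
  have hadj : ∀ a : Fin q, ((treeCopiesGraph t k q).scale m).graph.Adj (x, a) (y, a) :=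
    adj_tree hne hxy
  let p : ∀ a : Fin q, ((treeCopiesGraph t k q).scale m).graph.Walk (x, a) (y, a) := fun a =>
    SimpleGraph.Walk.cons (hadj a) SimpleGraph.Walk.nil
  have hplen : ∀ a, ((treeCopiesGraph t k q).scale m).walkLen (p a) = κ * L := by
    intro a
    simp only [p, walkLen_cons, walkLen_nil, add_zero]
    rw [len_scale_of_adj m (adj_tree hne hxy a), hcd a]
  have hhit : ∀ a, ∃ z ∈ H, z.2 = a := by
    intro a
    have hsupp : ∀ z ∈ (p a).support, z = (x, a) ∨ z = (y, a) := by
      intro z hz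
      simpa only [p, SimpleGraph.Walk.support_cons, SimpleGraph.Walk.support_nil,
        List.mem_cons, List.not_mem_nil, or_false] using hz
    have hshort : ((treeCopiesGraph t k q).scale m).IsShortest (p a) := by
      refine ⟨by simp [p, hne], ?_⟩
      rw [hplen, dist_scale, hcd a]
    have hball : ∀ z ∈ (p a).support,
        z ∈ ((treeCopiesGraph t k q).scale m).ball (y, ⟨0, hq⟩) (4 * (κ * L)) := by
      intro z hz
      have hz1 : copyDist z (y, ⟨0, hq⟩) ≤ 2 * L := by
        have h2 : ∀ w : TreeNode t k, 2 ^ min w.height y.height ≤ 2 ^ k := fun w =>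
          Nat.pow_le_pow_right (by norm_num) ((min_le_left _ _).trans (height_le w))
        rcases hsupp z hz with rfl | rfl
        · refine (copyDist_le _ _).trans ?_
          have := h2 x
          simp only [hT, ← hL]
          omega
        · refine (copyDist_le _ _).trans ?_
          have := h2 y
          simp only [treeDist_self]
          omega
      rw [ball, Set.mem_ofPred_eq, dist_scale, ENNReal.coe_lt_coe]
      have h3 : copyDist z (y, ⟨0, hq⟩) < 4 * L := by omega
      calc κ * copyDist z (y, ⟨0, hq⟩) < κ * (4 * L : ℕ) :=
            mul_lt_mul_of_pos_left (by exact_mod_cast h3) hκ0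
        _ = 4 * (κ * L) := by push_cast; ring
    obtain ⟨z, hz, hzH⟩ := hcov (x, a) (y, a) (p a) hshort (hplen a).ge hball
    refine ⟨z, hzH, ?_⟩
    rcases hsupp z hz with rfl | rfl <;> rfl
  have : Finset.univ ⊆ H.image Prod.snd := fun a _ => by
    obtain ⟨z, hz, hza⟩ := hhit a
    exact Finset.mem_image.2 ⟨z, hz, hza⟩
  have h1 := Finset.card_le_card this
  rw [Finset.card_univ, Fintype.card_fin] at h1
  exact h1.trans (Finset.card_image_le.trans hH)

theorem highwayDimension_scale (hm : 0 < m) (ht : 2 ≤ t) (hk : 2 ≤ k) :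
    ((treeCopiesGraph t k q).scale m).highwayDimension = q :=
  le_antisymm (Nat.sInf_le (highwayBound_scale hm hk))
    (le_csInf ⟨q, highwayBound_scale hm hk⟩ fun _ hh => le_of_highwayBound_scale hm ht hk hh)

end Highway

/-! ### Diameter. -/

section Diameter

theorem copyDist_le_pow (X Y : TreeNode t k × Fin q) :
    copyDist X Y ≤ 2 ^ (k + 1) * (3 * 16 ^ (k - 1)) := by
  have h1 := (treeDist_le X.1 Y.1).trans (Nat.mul_le_mul_left 2
    (Nat.pow_le_pow_right (by norm_num) (Nat.sub_le_sub_right (lcaHeight_le X.1 Y.1) 1) :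
      16 ^ (lcaHeight X.1 Y.1 - 1) ≤ 16 ^ (k - 1)))
  have h2 : 2 * 2 ^ min X.1.height Y.1.height ≤ 2 ^ (k + 1) :=
    two_mul_two_pow_le ((min_le_left _ _).trans (height_le _))
  have h3 : 1 ≤ 16 ^ (k - 1) := Nat.one_le_pow _ _ (by norm_num)
  have h4 := Nat.mul_le_mul_left (2 ^ (k + 1)) (show treeDist X.1 Y.1 + 1 ≤ 3 * 16 ^ (k - 1) by omega)
  rw [mul_add] at h4
  have := copyDist_le X Y
  omega

theorem diam_scale_le :
    ((treeCopiesGraph t k q).scale m).diam ≤ (m * (3 * 16 ^ (k - 1)) : ℝ≥0) := by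
  refine iSup_le fun X => iSup_le fun Y => ?_
  rw [dist_scale, ENNReal.coe_le_coe]
  have h : (copyDist X Y : ℝ≥0) ≤ 2 ^ (k + 1) * (3 * 16 ^ (k - 1)) := by
    exact_mod_cast copyDist_le_pow X Y
  refine (mul_le_mul_right h _).trans (le_of_eq ?_)
  field_simp

theorem le_diam_scale (ht : 2 ≤ t) (hk : 1 ≤ k) (hq : 1 ≤ q) :
    (m * 16 ^ (k - 1) : ℝ≥0) ≤ ((treeCopiesGraph t k q).scale m).diam := by
  let x : TreeNode t k := ⟨⟨1, by omega⟩, fun _ => ⟨0, by omega⟩⟩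
  let y : TreeNode t k := x.take 0 (Nat.zero_le _)
  have hyx : y.height = k := rfl
  have hxh : x.height = k - 1 := rfl
  have hxy : lcaHeight x y = y.height :=
    le_antisymm (lcaHeight_le _ _) (height_le_lcaHeight' _ _)
  have hT : 16 ^ (k - 1) ≤ treeDist x y := by
    rw [treeDist, climb_of_lt (by omega), hxy, hyx]
    omega
  refine le_trans ?_ (le_iSup_of_le (x, ⟨0, hq⟩) (le_iSup_of_le (y, ⟨0, hq⟩) le_rfl))
  rw [dist_scale, ENNReal.coe_le_coe, copyDist_same]
  push_cast
  have : (16 ^ (k - 1) : ℝ≥0) ≤ treeDist x y := by exact_mod_cast hT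
  refine (mul_le_mul_right this m).trans (le_of_eq ?_)
  field_simp

end Diameter

end LenGraph

/-! ### Root paths of leaves. -/

namespace TreeNode

variable {t k : ℕ}

/-- The ancestor of height `i` of the leaf `f`. -/
def ofLeaf (f : Fin k → Fin t) (i : ℕ) : TreeNode t k :=
  take ⟨Fin.last k, f⟩ (k - i) (Nat.sub_le _ _)

theorem height_ofLeaf (f : Fin k → Fin t) {i : ℕ} (hi : i ≤ k) : (ofLeaf f i).height = i := by
  rw [ofLeaf, height_take]
  omega

theorem lcaHeight_ofLeaf (f : Fin k → Fin t) {i j : ℕ} (hij : i ≤ j) :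
    lcaHeight (ofLeaf f i) (ofLeaf f j) = (ofLeaf f j).height := by
  refine le_antisymm ?_ (height_le_lcaHeight' _ _)
  have h : Agree (ofLeaf f i) (ofLeaf f j) (k - j) :=
    ⟨Nat.sub_le_sub_left hij k, le_rfl, fun r => rfl⟩
  exact Nat.sub_le_sub_left (agree_iff.1 h) k

theorem ofLeaf_ne (f : Fin k → Fin t) {i j : ℕ} (hij : i ≠ j) (hi : i ≤ k) (hj : j ≤ k) :
    ofLeaf f i ≠ ofLeaf f j := fun h => hij (by
  rw [← height_ofLeaf f hi, h, height_ofLeaf f hj])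

/-- Coordinate `k - j` is the choice made when descending from height `j`, so it does not affect the
ancestor at that height. -/
theorem ofLeaf_update (f : Fin k → Fin t) (c : Fin t) {j : ℕ}
    (r : Fin k) (hr : (r : ℕ) = k - j) : ofLeaf (Function.update f r c) j = ofLeaf f j := by
  refine eq_of_agree rfl ⟨le_rfl, le_rfl, fun s => ?_⟩
  refine Function.update_of_ne (fun h => ?_) _ _
  have h1 := s.2
  have h2 : (s : ℕ) = r := congrArg Fin.val h
  have h3 : ((ofLeaf (Function.update f r c) j).1 : ℕ) = k - j := rfl
  omega

theorem isLca_ofLeaf_update (f : Fin k → Fin t) {c d : Fin t} (hcd : c ≠ d) {i j : ℕ} (hij : i < j)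
    (hjk : j ≤ k) (r : Fin k) (hr : (r : ℕ) = k - j) :
    IsLca (ofLeaf f j) (ofLeaf (Function.update f r c) i)
      (ofLeaf (Function.update f r d) i) := by
  have hc := lcaHeight_ofLeaf (Function.update f r c) hij.le
  have hd := lcaHeight_ofLeaf (Function.update f r d) hij.le
  rw [ofLeaf_update f c r hr] at hc
  rw [ofLeaf_update f d r hr, lcaHeight_comm] at hd
  refine ⟨le_antisymm ?_ ?_, hc, hd⟩
  · by_contra hcon
    rw [height_ofLeaf f hjk, lcaHeight] at hcon
    have h1 : r.1 + 1 ≤ commonDepth (ofLeaf (Function.update f r c) i)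
      (ofLeaf (Function.update f r d) i) := by omega
    obtain ⟨_, _, h2⟩ := agree_iff.2 h1
    have h3 : Function.update f r c r = Function.update f r d r := h2 (Fin.last r.1)
    simp [hcd] at h3
  · have := lcaHeight_ultra (ofLeaf (Function.update f r c) i) (ofLeaf f j)
      (ofLeaf (Function.update f r d) i)
    rwa [hc, hd, max_self] at this

theorem ofLeaf_update_ne (f : Fin k → Fin t) {c d : Fin t} (hcd : c ≠ d) {i j : ℕ} (hij : i < j)
    (hjk : j ≤ k) (r : Fin k) (hr : (r : ℕ) = k - j) :
    ofLeaf (Function.update f r c) i ≠ ofLeaf (Function.update f r d) i := fun h => by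
  have h1 := (isLca_ofLeaf_update f hcd hij hjk r hr).1
  rw [h, lcaHeight_self, height_ofLeaf _ hjk, height_ofLeaf _ (by omega)] at h1
  omega

end TreeNode

/-! ### Forced edges of `G⁺` and the count of bad leaves. -/

namespace LenGraph

open TreeNode

variable {t k q : ℕ} {m : ℝ≥0}

theorem adj_plus_scale (hm : 0 < m) (θ : Ordering (TreeNode t k × Fin q))
    {U V W : TreeNode t k × Fin q} (hUW : U ≠ W) (hUV : (treeCopiesGraph t k q).graph.Adj U V)
    (hVW : (treeCopiesGraph t k q).graph.Adj V W) (hU : θ.symm V < θ.symm U)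
    (hW : θ.symm V < θ.symm W)
    (hZ : ∀ Z, Z ≠ U → Z ≠ V → Z ≠ W →
      copyDist U V + copyDist V W < copyDist U Z + copyDist Z W) :
    (((treeCopiesGraph t k q).scale m).plus θ).graph.Adj U W := by
  refine adj_plus_of_unique _ θ hUW hUV hVW hU hW fun Z h1 h2 h3 => ?_
  rw [len_scale_of_adj m hUV, len_scale_of_adj m hVW, dist_scale, dist_scale, ← ENNReal.coe_add,
    ENNReal.coe_lt_coe, ← mul_add, ← mul_add]
  exact mul_lt_mul_of_pos_left (by exact_mod_cast hZ Z h1 h2 h3) (by positivity)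

/-- The path `u`–`v`–`w` is the unique shortest one: within the copy by `treeDist_lt`, and leaving
the copy costs extra. -/
theorem adj_plus_of_isLca (hm : 0 < m) (θ : Ordering (TreeNode t k × Fin q))
    {u v w : TreeNode t k} (b : Fin q) (hv : IsLca v u w) (hu : u ≠ v) (hw : w ≠ v) (huw : u ≠ w)
    (h1 : θ.symm (v, b) < θ.symm (u, b)) (h2 : θ.symm (v, b) < θ.symm (w, b)) :
    (((treeCopiesGraph t k q).scale m).plus θ).graph.Adj (u, b) (w, b) := by
  refine adj_plus_scale hm θ (fun h => huw (congrArg Prod.fst h)) (adj_tree hu hv.2.1 b)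
    (adj_tree hw hv.symm.2.1 b).symm h1 h2 ?_
  rintro ⟨z, c⟩ hz1 hz2 hz3
  rw [copyDist_same, copyDist_same, ← mul_add, ← hv.treeDist]
  by_cases hc : c = b
  · subst hc
    rw [copyDist_same, copyDist_same, ← mul_add]
    refine Nat.mul_lt_mul_of_pos_left (treeDist_lt (fun h => hz1 (by rw [h]))
      (fun h => hz3 (by rw [h])) fun h => hz2 (by rw [h.unique hv])) (by positivity)
  · have hT := Nat.mul_le_mul_left (2 ^ (k + 1)) (treeDist_triangle u z w)
    rw [mul_add] at hT
    have h3 := mul_treeDist_le_copyDist (z, c) (w, b)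
    rw [copyDist_of_ne (X := (u, b)) (Y := (z, c)) (Ne.symm hc)]
    have : 0 < 2 ^ min u.height z.height := by positivity
    simp only at h3 ⊢
    omega

/-- The path changes copy at `x` and then climbs to `y`. It is uniquely shortest: a third copy of
`x` means two changes, changing at `y` costs more since `y` is higher, and any other node costs a
whole extra tree unit. -/
theorem adj_plus_cross (hm : 0 < m) (θ : Ordering (TreeNode t k × Fin q))
    {x y : TreeNode t k} (h : lcaHeight x y = y.height) (hne : x ≠ y) {b c : Fin q} (hbc : b ≠ c)
    (h1 : θ.symm (x, b) < θ.symm (x, c)) (h2 : θ.symm (x, b) < θ.symm (y, b)) :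
    (((treeCopiesGraph t k q).scale m).plus θ).graph.Adj (x, c) (y, b) := by
  refine adj_plus_scale hm θ (fun h => hne (congrArg Prod.fst h)) (adj_copy x hbc.symm)
    (adj_tree hne h b) h1 h2 ?_
  rintro ⟨z, d⟩ hz1 hz2 hz3
  have hlt : x.height < y.height := by
    have h3 := height_le_lcaHeight x y
    refine lt_of_le_of_ne (by omega) fun h4 => hne (eq_of_lcaHeight (by omega) (by omega))
  rw [copyDist_same, copyDist_of_ne (X := (x, c)) (Y := (x, b)) hbc.symm]
  simp only [treeDist_self, min_self, mul_zero, zero_add]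
  have hpos : 0 < 2 ^ x.height := by positivity
  by_cases hzx : z = x
  · subst hzx
    have hd1 : c ≠ d := fun h => hz1 (by rw [h])
    have hd2 : d ≠ b := fun h => hz2 (by rw [h])
    rw [copyDist_of_ne (X := (z, c)) (Y := (z, d)) hd1, copyDist_of_ne (X := (z, d)) hd2]
    simp only [min_self, min_eq_left hlt.le]
    omega
  by_cases hzy : z = y
  · subst hzy
    have hd2 : d ≠ b := fun h => hz3 (by rw [h])
    have h3 := mul_treeDist_le_copyDist (x, c) (z, d)
    rw [copyDist_of_ne (X := (z, d)) hd2]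
    have : 2 ^ x.height < 2 ^ z.height := Nat.pow_lt_pow_right (by norm_num) hlt
    simp only [min_self] at h3 ⊢
    omega
  have hlca : ¬ IsLca z x y := fun hz => hzy (hz.unique ⟨h.symm, h, lcaHeight_self y⟩)
  have h3 := treeDist_step (treeDist_lt hzx hzy hlca)
  have h4 := mul_treeDist_le_copyDist (x, c) (z, d)
  have h5 := mul_treeDist_le_copyDist (z, d) (y, b)
  simp only at h4 h5
  omega

open Classical in
/-- Among leaves that differ only below a common ancestor `v`, few have an ancestor below `v` that
is contracted after `v` and has a small upward degree. -/
theorem card_bad_line_le (hm : 0 < m) (θ : Ordering (TreeNode t k × Fin q)) (K : ℕ)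
    (f : Fin k → Fin t) {i j : ℕ} (hij : i < j) (hjk : j ≤ k) (b : Fin q)
    (r : Fin k) (hr : (r : ℕ) = k - j) :
    (Finset.univ.filter fun c : Fin t =>
      θ.symm (ofLeaf (Function.update f r c) j, b) < θ.symm (ofLeaf (Function.update f r c) i, b) ∧
      (((treeCopiesGraph t k q).scale m).upward θ
        (ofLeaf (Function.update f r c) i, b)).card < K).card ≤ K := by
  set S := Finset.univ.filter fun c : Fin t =>
      θ.symm (ofLeaf (Function.update f r c) j, b) < θ.symm (ofLeaf (Function.update f r c) i, b) ∧
      (((treeCopiesGraph t k q).scale m).upward θ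
        (ofLeaf (Function.update f r c) i, b)).card < K with hS
  rcases S.eq_empty_or_nonempty with h0 | h0
  · simp [h0]
  -- The first contracted vertex of `S` has upward edges to all the others, because their common
  -- ancestor is contracted earlier still. So `S` has at most one element more than this upward
  -- degree.
  obtain ⟨c, hc, hmin⟩ := S.exists_min_image
    (fun c => θ.symm (ofLeaf (Function.update f r c) i, b)) h0
  have hmem : ∀ d ∈ S, θ.symm (ofLeaf f j, b) < θ.symm (ofLeaf (Function.update f r d) i, b) := by
    intro d hd
    have := (Finset.mem_filter.1 hd).2.1
    rwa [ofLeaf_update f d r hr] at this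
  have hinj : ∀ d e, d ≠ e → ofLeaf (Function.update f r d) i ≠ ofLeaf (Function.update f r e) i :=
    fun d e hde => ofLeaf_update_ne f hde hij hjk r hr
  have hnej : ∀ d, ofLeaf (Function.update f r d) i ≠ ofLeaf f j := by
    intro d
    rw [← ofLeaf_update f d r hr]
    exact ofLeaf_ne _ hij.ne (by omega) hjk
  have hsub : (S.erase c).card ≤ (((treeCopiesGraph t k q).scale m).upward θ
      (ofLeaf (Function.update f r c) i, b)).card := by
    refine Finset.card_le_card_of_injOn (fun d => (ofLeaf (Function.update f r d) i, b)) ?_ ?_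
    · intro d hd
      obtain ⟨hdc, hd⟩ := Finset.mem_erase.1 hd
      rw [Finset.mem_coe, mem_upward]
      refine ⟨adj_plus_of_isLca hm θ b (isLca_ofLeaf_update f hdc.symm hij hjk r hr) (hnej c)
        (hnej d) (hinj c d hdc.symm) (hmem c hc) (hmem d hd), ?_⟩
      refine lt_of_le_of_ne (hmin d hd) fun h => ?_
      exact hinj c d hdc.symm (congrArg Prod.fst (θ.symm.injective h))
    · intro d _ e _ hde
      by_contra hne
      exact hinj d e hne (congrArg Prod.fst hde)
  rw [Finset.card_erase_of_mem hc] at hsub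
  have := (Finset.mem_filter.1 hc).2.2
  omega

open Classical in
/-- A set of functions that meets each line in direction `r` in at most `K` points is small. -/
theorem card_filter_le_of_line (P : (Fin k → Fin t) → Prop) (r : Fin k) (K : ℕ)
    (h : ∀ f, (Finset.univ.filter fun c => P (Function.update f r c)).card ≤ K) :
    t * (Finset.univ.filter P).card ≤ K * t ^ k := by
  -- Exchanging coordinate `r` with the extra entry is an involution; it turns the sum over lines
  -- into `t` times the sum over points.
  let e : (Fin k → Fin t) × Fin t ≃ (Fin k → Fin t) × Fin t :=
    Function.Involutive.toPerm (fun x => (Function.update x.1 r x.2, x.1 r)) (fun x => by simp)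
  have h1 : ∑ x : (Fin k → Fin t) × Fin t, (if P (Function.update x.1 r x.2) then 1 else 0) =
      ∑ x : (Fin k → Fin t) × Fin t, (if P x.1 then 1 else 0) :=
    Fintype.sum_equiv e _ _ fun x => rfl
  have h2 : t * (Finset.univ.filter P).card =
      ∑ x : (Fin k → Fin t) × Fin t, (if P x.1 then 1 else 0) := by
    rw [Fintype.sum_prod_type, Finset.card_filter, Finset.mul_sum]
    refine Finset.sum_congr rfl fun f _ => ?_
    by_cases hf : P f <;> simp [hf]
  rw [h2, ← h1, Fintype.sum_prod_type]
  simp only [← Finset.card_filter]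
  calc _ ≤ ∑ _f : Fin k → Fin t, K := Finset.sum_le_sum fun f _ => h f
    _ = K * t ^ k := by simp [mul_comm]

end LenGraph

/-! ### Lower bound for the average query time. -/

namespace LenGraph

open TreeNode

variable {t k q : ℕ} {m : ℝ≥0}

/-- All pairs `(i, j)` and `(b, c)` yield an edge of the augmented graph on the path to a leaf above
which the contraction ordering increases in each copy. -/
theorem adj_plus_or (hm : 0 < m) (θ : Ordering (TreeNode t k × Fin q)) (f : Fin k → Fin t)
    (hmono : ∀ i j, i < j → j ≤ k → ∀ b, θ.symm (ofLeaf f i, b) < θ.symm (ofLeaf f j, b))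
    {i j : ℕ} (hij : i < j) (hj : j ≤ k) (b c : Fin q) :
    (((treeCopiesGraph t k q).scale m).plus θ).graph.Adj (ofLeaf f i, c) (ofLeaf f j, b) ∨
      (((treeCopiesGraph t k q).scale m).plus θ).graph.Adj (ofLeaf f i, b) (ofLeaf f j, c) := by
  have hl := lcaHeight_ofLeaf f hij.le
  have hne := ofLeaf_ne f hij.ne (by omega) hj
  rcases eq_or_ne b c with rfl | hbc
  · exact Or.inl (adj_plus _ θ (adj_tree hne hl b))
  rcases lt_or_gt_of_ne (fun h => hbc (congrArg Prod.snd (θ.symm.injective h)) :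
    θ.symm (ofLeaf f i, b) ≠ θ.symm (ofLeaf f i, c)) with h | h
  · exact Or.inl (adj_plus_cross hm θ hl hne hbc h (hmono i j hij hj b))
  · exact Or.inr (adj_plus_cross hm θ hl hne hbc.symm h (hmono i j hij hj c))

-- The search reaches the copies of the leaf in `U`, and from them by tree edges all their ancestors
-- in the same copies. `adj_plus_or` supplies edges among these vertices, each scanned at its
-- earlier endpoint. One factor 2 comes from the alternative in `adj_plus_or`, the other from
-- counting edges in both directions.
open Classical in
theorem mul_card_sq_le_searchTime (hm : 0 < m) (θ : Ordering (TreeNode t k × Fin q))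
    (f : Fin k → Fin t)
    (hmono : ∀ i j, i < j → j ≤ k → ∀ b, θ.symm (ofLeaf f i, b) < θ.symm (ofLeaf f j, b))
    (a : Fin q) :
    k * (k + 1) * (Finset.univ.filter fun b =>
      θ.symm (ofLeaf f 0, a) ≤ θ.symm (ofLeaf f 0, b)).card ^ 2 ≤
      4 * ((treeCopiesGraph t k q).scale m).searchTime θ (ofLeaf f 0, a) := by
  set G := (treeCopiesGraph t k q).scale m
  set U := Finset.univ.filter fun b => θ.symm (ofLeaf f 0, a) ≤ θ.symm (ofLeaf f 0, b) with hU
  let g : Fin (k + 1) × Fin q → TreeNode t k × Fin q := fun x => (ofLeaf f x.1, x.2)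
  have hg : Function.Injective g := by
    rintro ⟨i, b⟩ ⟨j, c⟩ h
    simp only [g, Prod.mk.injEq] at h
    refine Prod.ext (Fin.ext ?_) h.2
    by_contra hne
    exact ofLeaf_ne f hne (Nat.lt_succ_iff.1 i.2) (Nat.lt_succ_iff.1 j.2) h.1
  let J : Finset (Fin (k + 1) × Fin q) := Finset.univ ×ˢ U
  have hreach : ∀ x ∈ J.image g,
      Relation.ReflTransGen (fun v w => w ∈ G.upward θ v) (ofLeaf f 0, a) x := by
    intro x hx
    obtain ⟨⟨i, b⟩, hib, rfl⟩ := Finset.mem_image.1 hx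
    simp only [J, hU, Finset.mem_product, Finset.mem_filter, Finset.mem_univ, true_and] at hib
    have h1 : Relation.ReflTransGen (fun v w => w ∈ G.upward θ v) (ofLeaf f 0, a)
        (ofLeaf f 0, b) := by
      rcases eq_or_ne a b with rfl | hab
      · exact .refl
      · refine .single ((mem_upward _ _).2 ⟨adj_plus _ θ (adj_copy _ hab), ?_⟩)
        exact lt_of_le_of_ne hib fun h => hab (congrArg Prod.snd (θ.symm.injective h))
    rcases Nat.eq_zero_or_pos (i : ℕ) with hi | hi
    · simpa [g, hi] using h1
    · have hik := Nat.lt_succ_iff.1 i.2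
      refine h1.tail ((mem_upward _ _).2 ⟨adj_plus _ θ (adj_tree ?_ ?_ b), hmono 0 i hi hik b⟩)
      · exact ofLeaf_ne f hi.ne (Nat.zero_le _) hik
      · exact lcaHeight_ofLeaf f hi.le
  have hsum := G.sum_upward_le_searchTime θ (ofLeaf f 0, a) (J.image g) hreach
  rw [Finset.sum_image hg.injOn] at hsum
  have hA : ∑ x ∈ J, ∑ y ∈ J, (if g y ∈ G.upward θ (g x) then 1 else 0) ≤
      G.searchTime θ (ofLeaf f 0, a) := by
    refine le_trans (Finset.sum_le_sum fun x _ => ?_) hsum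
    rw [← Finset.card_filter]
    refine Finset.card_le_card_of_injOn g (fun y hy => ?_) hg.injOn
    exact (Finset.mem_filter.1 hy).2
  have hE : ∑ x ∈ J, ∑ y ∈ J, (if (G.plus θ).graph.Adj (g x) (g y) then 1 else 0) ≤
      2 * G.searchTime θ (ofLeaf f 0, a) := by
    have h1 : ∀ x y, (if (G.plus θ).graph.Adj (g x) (g y) then 1 else 0) ≤
        (if g y ∈ G.upward θ (g x) then 1 else 0) + (if g x ∈ G.upward θ (g y) then 1 else 0) := by
      intro x y
      by_cases h : (G.plus θ).graph.Adj (g x) (g y)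
      · rw [if_pos h]
        rcases lt_or_gt_of_ne (fun h' => h.ne (θ.symm.injective h') :
          θ.symm (g x) ≠ θ.symm (g y)) with h2 | h2
        · rw [if_pos ((mem_upward _ _).2 ⟨h, h2⟩)]
          omega
        · rw [if_pos (c := g x ∈ _) ((mem_upward _ _).2 ⟨h.symm, h2⟩)]
          omega
      · rw [if_neg h]
        exact Nat.zero_le _
    refine (Finset.sum_le_sum fun x _ => Finset.sum_le_sum fun y _ => h1 x y).trans ?_
    simp only [Finset.sum_add_distrib]
    rw [Finset.sum_comm (f := fun x y => if g x ∈ G.upward θ (g y) then 1 else 0)]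
    omega
  have hor : ∀ (i j : Fin (k + 1)) (b c : Fin q), (if i ≠ j then 1 else 0) ≤
      (if (G.plus θ).graph.Adj (g (i, c)) (g (j, b)) then 1 else 0) +
      (if (G.plus θ).graph.Adj (g (i, b)) (g (j, c)) then 1 else 0) := by
    intro i j b c
    by_cases hij : i = j
    · simp [hij]
    · rw [if_pos hij]
      have : (G.plus θ).graph.Adj (g (i, c)) (g (j, b)) ∨
          (G.plus θ).graph.Adj (g (i, b)) (g (j, c)) := by
        rcases lt_or_gt_of_ne hij with h | h
        · exact adj_plus_or hm θ f hmono h (Nat.lt_succ_iff.1 j.2) b c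
        · exact (adj_plus_or hm θ f hmono h (Nat.lt_succ_iff.1 i.2) b c).symm.imp
            (fun h => h.symm) (fun h => h.symm)
      rcases this with h | h
      · rw [if_pos h]
        omega
      · rw [if_pos h]
        omega
  have hcount : ∑ i : Fin (k + 1), ∑ j : Fin (k + 1), (if i ≠ j then 1 else 0) = k * (k + 1) := by
    have : ∀ i : Fin (k + 1), ∑ j : Fin (k + 1), (if i ≠ j then 1 else 0) = k := by
      intro i
      rw [← Finset.card_filter, Finset.filter_ne, Finset.card_erase_of_mem (Finset.mem_univ _)]
      simp
    rw [Finset.sum_congr rfl fun i _ => this i]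
    simp [mul_comm]
  have hF : ∑ i : Fin (k + 1), ∑ j : Fin (k + 1), ∑ c ∈ U, ∑ b ∈ U,
      (if (G.plus θ).graph.Adj (g (i, c)) (g (j, b)) then 1 else 0) ≤
      2 * G.searchTime θ (ofLeaf f 0, a) := by
    refine le_trans (le_of_eq ?_) hE
    simp only [J, Finset.sum_product]
    refine Finset.sum_congr rfl fun i _ => ?_
    rw [Finset.sum_comm]
  have hlow : k * (k + 1) * U.card ^ 2 ≤
      2 * ∑ i : Fin (k + 1), ∑ j : Fin (k + 1), ∑ c ∈ U, ∑ b ∈ U,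
      (if (G.plus θ).graph.Adj (g (i, c)) (g (j, b)) then 1 else 0) := by
    rw [← hcount, Finset.sum_mul, Finset.mul_sum]
    refine Finset.sum_le_sum fun i _ => ?_
    rw [Finset.sum_mul, Finset.mul_sum]
    refine Finset.sum_le_sum fun j _ => ?_
    calc _ = ∑ _b ∈ U, ∑ _c ∈ U, (if i ≠ j then 1 else 0) := by
          simp only [Finset.sum_const, smul_eq_mul]
          ring
      _ ≤ _ := Finset.sum_le_sum fun b _ => Finset.sum_le_sum fun c _ => hor i j b c
      _ = _ := by
          simp only [Finset.sum_add_distrib]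
          rw [Finset.sum_comm, two_mul]
  omega

-- Every pair is comparable, so the ranks sum to at least `q ^ 2 / 2`; Cauchy–Schwarz does the rest.
open Classical in
theorem cube_le_sum_rank_sq {N : ℕ} (p : Fin q → Fin N) :
    q ^ 3 ≤ 4 * ∑ a, (Finset.univ.filter fun b => p a ≤ p b).card ^ 2 := by
  rcases Nat.eq_zero_or_pos q with rfl | hq
  · simp
  have h1 : q ^ 2 ≤ 2 * ∑ a, (Finset.univ.filter fun b => p a ≤ p b).card := by
    simp only [Finset.card_filter]
    calc q ^ 2 = ∑ _a : Fin q, ∑ _b : Fin q, 1 := by simp [sq]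
      _ ≤ ∑ a, ∑ b, ((if p a ≤ p b then 1 else 0) + if p b ≤ p a then 1 else 0) :=
        Finset.sum_le_sum fun a _ => Finset.sum_le_sum fun b _ => by
          rcases le_total (p a) (p b) with h | h <;> simp [h]
      _ = _ := by
        simp only [Finset.sum_add_distrib]
        rw [Finset.sum_comm (f := fun a b => if p b ≤ p a then 1 else 0), two_mul]
  have h2 := sq_sum_le_card_mul_sum_sq (s := (Finset.univ : Finset (Fin q)))
    (f := fun a => (Finset.univ.filter fun b => p a ≤ p b).card)
  rw [Finset.card_univ, Fintype.card_fin] at h2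
  refine Nat.le_of_mul_le_mul_left ?_ hq
  calc q * q ^ 3 = (q ^ 2) ^ 2 := by ring
    _ ≤ (2 * ∑ a, (Finset.univ.filter fun b => p a ≤ p b).card) ^ 2 := Nat.pow_le_pow_left h1 2
    _ = 4 * (∑ a, (Finset.univ.filter fun b => p a ≤ p b).card) ^ 2 := by ring
    _ ≤ 4 * (q * ∑ a, (Finset.univ.filter fun b => p a ≤ p b).card ^ 2) :=
      Nat.mul_le_mul_left _ h2
    _ = _ := by ring

theorem le_sum_searchTime_of_mono (hm : 0 < m) (θ : Ordering (TreeNode t k × Fin q))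
    (f : Fin k → Fin t)
    (hmono : ∀ i j, i < j → j ≤ k → ∀ b, θ.symm (ofLeaf f i, b) < θ.symm (ofLeaf f j, b)) :
    q ^ 3 * k ^ 2 ≤
      16 * ∑ a, ((treeCopiesGraph t k q).scale m).searchTime θ (ofLeaf f 0, a) := by
  classical
  have h1 := cube_le_sum_rank_sq fun a => θ.symm (ofLeaf f 0, a)
  have h2 := Finset.sum_le_sum fun a (_ : a ∈ (Finset.univ : Finset (Fin q))) =>
    mul_card_sq_le_searchTime hm θ f hmono a
  rw [← Finset.mul_sum, ← Finset.mul_sum] at h2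
  calc q ^ 3 * k ^ 2 ≤ _ := Nat.mul_le_mul_right _ h1
    _ = 4 * (k * k * _) := by ring
    _ ≤ 4 * (k * (k + 1) * _) :=
      Nat.mul_le_mul_left _ (Nat.mul_le_mul_right _ (Nat.mul_le_mul_left _ (Nat.le_succ k)))
    _ ≤ 4 * (4 * _) := Nat.mul_le_mul_left _ h2
    _ = _ := by ring

/-- In copy `b`, the ancestor of height `j` of the leaf `f` is contracted before the one of height
`i`, which has fewer than `K` upward edges. -/
def Inverted (m : ℝ≥0) (θ : Ordering (TreeNode t k × Fin q)) (K i j : ℕ) (b : Fin q)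
    (f : Fin k → Fin t) : Prop :=
  i < j ∧ j ≤ k ∧ θ.symm (ofLeaf f j, b) < θ.symm (ofLeaf f i, b) ∧
    (((treeCopiesGraph t k q).scale m).upward θ (ofLeaf f i, b)).card < K

theorem upward_le_searchTime {V : Type} [Fintype V] (G : LenGraph V) (θ : Ordering V) {s x : V}
    (h : Relation.ReflTransGen (fun v w => w ∈ G.upward θ v) s x) :
    (G.upward θ x).card ≤ G.searchTime θ s := by
  simpa using G.sum_upward_le_searchTime θ s {x} (by simpa using h)

/-- If the order is violated at `i < j`, the vertex at height `i` has large upward degree. Either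
the leaf is contracted before it and reaches it by one tree edge, or the leaf itself violates the
order with it and has large upward degree. -/
theorem le_sum_searchTime (hm : 0 < m) (θ : Ordering (TreeNode t k × Fin q)) (f : Fin k → Fin t)
    (h : ∀ i j b, ¬ Inverted m θ (q ^ 3 * k ^ 2) i j b f) :
    q ^ 3 * k ^ 2 ≤
      16 * ∑ a, ((treeCopiesGraph t k q).scale m).searchTime θ (ofLeaf f 0, a) := by
  by_cases hmono : ∀ i j, i < j → j ≤ k → ∀ b, θ.symm (ofLeaf f i, b) < θ.symm (ofLeaf f j, b)
  · exact le_sum_searchTime_of_mono hm θ f hmono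
  set G := (treeCopiesGraph t k q).scale m
  have key : ∀ i j b, i < j → j ≤ k → ¬ θ.symm (ofLeaf f i, b) < θ.symm (ofLeaf f j, b) →
      q ^ 3 * k ^ 2 ≤ (G.upward θ (ofLeaf f i, b)).card := by
    intro i j b hij hj hlt
    by_contra hcon
    refine h i j b ⟨hij, hj, lt_of_le_of_ne (not_lt.1 hlt) fun h' => ?_, not_le.1 hcon⟩
    exact ofLeaf_ne f hij.ne (by omega) hj (congrArg Prod.fst (θ.symm.injective h')).symm
  push Not at hmono
  obtain ⟨i, j, hij, hj, b, hb⟩ := hmono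
  have h1 := key i j b hij hj (not_lt.2 hb)
  have h2 : q ^ 3 * k ^ 2 ≤ G.searchTime θ (ofLeaf f 0, b) := by
    rcases Nat.eq_zero_or_pos i with rfl | hi
    · exact h1.trans (G.upward_le_searchTime θ .refl)
    by_cases h0 : θ.symm (ofLeaf f 0, b) < θ.symm (ofLeaf f i, b)
    · refine h1.trans (G.upward_le_searchTime θ (.single ((mem_upward _ _).2 ⟨?_, h0⟩)))
      exact adj_plus _ θ (adj_tree (ofLeaf_ne f hi.ne (Nat.zero_le _) (by omega))
        (lcaHeight_ofLeaf f hi.le) b)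
    · exact (key 0 i b hi (by omega) h0).trans (G.upward_le_searchTime θ .refl)
  have h3 := Finset.single_le_sum (f := fun a => G.searchTime θ (ofLeaf f 0, a))
    (fun _ _ => Nat.zero_le _) (Finset.mem_univ b)
  omega

-- A union bound over `(i, j, b)`; for each triple the line argument is applied to coordinate `k -
-- j`.
open Classical in
theorem card_inverted_le (hm : 0 < m) (θ : Ordering (TreeNode t k × Fin q)) (K : ℕ) :
    t * (Finset.univ.filter fun f => ∃ i j b, Inverted m θ K i j b f).card ≤
      (k + 1) ^ 2 * q * K * t ^ k := by
  have h1 : (Finset.univ.filter fun f => ∃ i j b, Inverted m θ K i j b f) ⊆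
      (Finset.univ : Finset (Fin (k + 1) × Fin (k + 1) × Fin q)).biUnion fun x =>
        Finset.univ.filter fun f => Inverted m θ K x.1 x.2.1 x.2.2 f := by
    intro f hf
    obtain ⟨i, j, b, h⟩ := (Finset.mem_filter.1 hf).2
    obtain ⟨hij, hj, -⟩ := id h
    exact Finset.mem_biUnion.2 ⟨(⟨i, by omega⟩, ⟨j, by omega⟩, b), Finset.mem_univ _,
      Finset.mem_filter.2 ⟨Finset.mem_univ _, h⟩⟩
  have h2 : ∀ x : Fin (k + 1) × Fin (k + 1) × Fin q,
      t * (Finset.univ.filter fun f => Inverted m θ K x.1 x.2.1 x.2.2 f).card ≤ K * t ^ k := by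
    rintro ⟨i, j, b⟩
    by_cases hij : (i : ℕ) < j
    · have hj := Nat.lt_succ_iff.1 j.2
      let r : Fin k := ⟨k - j, by omega⟩
      refine card_filter_le_of_line _ r K fun f => ?_
      refine (Finset.card_le_card fun c hc => ?_).trans
        (card_bad_line_le hm θ K f hij hj b r rfl)
      exact Finset.mem_filter.2 ⟨Finset.mem_univ _, (Finset.mem_filter.1 hc).2.2.2⟩
    · have : (Finset.univ.filter fun f => Inverted m θ K i j b f) = ∅ :=
        Finset.filter_eq_empty_iff.2 fun f _ h => hij h.1
      simp [this]
  calc _ ≤ t * ∑ x : Fin (k + 1) × Fin (k + 1) × Fin q,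
        (Finset.univ.filter fun f => Inverted m θ K x.1 x.2.1 x.2.2 f).card :=
        Nat.mul_le_mul_left _ ((Finset.card_le_card h1).trans Finset.card_biUnion_le)
    _ ≤ ∑ _x : Fin (k + 1) × Fin (k + 1) × Fin q, K * t ^ k := by
        rw [Finset.mul_sum]
        exact Finset.sum_le_sum fun x _ => h2 x
    _ = _ := by
        simp only [Finset.sum_const, Finset.card_univ, Fintype.card_prod, Fintype.card_fin,
          smul_eq_mul]
        ring

theorem card_treeNode (t k : ℕ) :
    Fintype.card (TreeNode t k) = ∑ d : Fin (k + 1), t ^ (d : ℕ) := by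
  simp [TreeNode, Fintype.card_sigma]

theorem pow_le_card_treeNode (t k : ℕ) : t ^ k ≤ Fintype.card (TreeNode t k) := by
  rw [card_treeNode]
  exact Finset.single_le_sum (f := fun d : Fin (k + 1) => t ^ (d : ℕ)) (fun _ _ => Nat.zero_le _)
    (Finset.mem_univ (Fin.last k))

theorem card_treeNode_le (ht : 2 ≤ t) (k : ℕ) : Fintype.card (TreeNode t k) ≤ 2 * t ^ k := by
  rw [card_treeNode, Fin.sum_univ_eq_sum_range (fun d => t ^ d)]
  induction k with
  | zero => simp
  | succ k ih =>
    rw [Finset.sum_range_succ]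
    have := Nat.mul_le_mul_right (t ^ k) ht
    rw [pow_succ' t k]
    omega

/-- The bound on `t` makes at least half of the `t ^ k` leaves good, and the tree has at most `2 * t
^ k` nodes. With 16 from `le_sum_searchTime` and the two searches per query this gives 32. -/
theorem le_avgQueryTime (hm : 0 < m) (hq : 1 ≤ q) (ht : 2 ≤ t)
    (htk : 2 * ((k + 1) ^ 2 * q * (q ^ 3 * k ^ 2)) ≤ t) (θ : Ordering (TreeNode t k × Fin q)) :
    ((q : ℝ) * k) ^ 2 / 32 ≤ ((treeCopiesGraph t k q).scale m).avgQueryTime θ := by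
  classical
  set G := (treeCopiesGraph t k q).scale m
  have : Nonempty (TreeNode t k × Fin q) := ⟨(⟨0, fun i => i.elim0⟩, ⟨0, hq⟩)⟩
  set B := Finset.univ.filter fun f => ∃ i j b, Inverted m θ (q ^ 3 * k ^ 2) i j b f
  have hB : 2 * B.card ≤ t ^ k := by
    have h1 := card_inverted_le hm θ (q ^ 3 * k ^ 2)
    have h2 := Nat.mul_le_mul_right (t ^ k) htk
    refine Nat.le_of_mul_le_mul_left (?_ : t * _ ≤ t * _) (by omega)
    calc t * (2 * B.card) = 2 * (t * B.card) := by ring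
      _ ≤ 2 * _ := Nat.mul_le_mul_left _ h1
      _ = _ := by ring
      _ ≤ _ := h2
  have hBc : t ^ k ≤ 2 * Bᶜ.card := by
    rw [Finset.card_compl, Fintype.card_fun, Fintype.card_fin, Fintype.card_fin]
    omega
  have hsum : Bᶜ.card * (q ^ 3 * k ^ 2) ≤ 16 * ∑ s, G.searchTime θ s := by
    have h1 : ∑ f : Fin k → Fin t, ∑ a, G.searchTime θ (ofLeaf f 0, a) ≤
        ∑ s, G.searchTime θ s := by
      rw [← Fintype.sum_prod_type']
      let g : (Fin k → Fin t) × Fin q → TreeNode t k × Fin q := fun x => (ofLeaf x.1 0, x.2)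
      have hg : Function.Injective g := by
        rintro ⟨f, a⟩ ⟨f', a'⟩ h
        simp only [g, Prod.mk.injEq] at h
        refine Prod.ext ?_ h.2
        have h3 : (⟨Fin.last k, f⟩ : TreeNode t k) = ⟨Fin.last k, f'⟩ := h.1
        exact sigma_mk_injective h3
      rw [← Finset.sum_image (s := Finset.univ) (g := g) (f := G.searchTime θ) hg.injOn]
      exact Finset.sum_le_sum_of_subset (Finset.subset_univ _)
    calc _ = ∑ f ∈ Bᶜ, q ^ 3 * k ^ 2 := by simp
      _ ≤ ∑ f ∈ Bᶜ, 16 * ∑ a, G.searchTime θ (ofLeaf f 0, a) :=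
        Finset.sum_le_sum fun f hf => le_sum_searchTime hm θ f fun i j b h =>
          Finset.mem_compl.1 hf (Finset.mem_filter.2 ⟨Finset.mem_univ _, i, j, b, h⟩)
      _ ≤ ∑ f, 16 * ∑ a, G.searchTime θ (ofLeaf f 0, a) :=
        Finset.sum_le_sum_of_subset (Finset.subset_univ _)
      _ ≤ _ := by
        rw [← Finset.mul_sum]
        exact Nat.mul_le_mul_left _ h1
  have hcard : Fintype.card (TreeNode t k × Fin q) ≤ 2 * t ^ k * q := by
    rw [Fintype.card_prod, Fintype.card_fin]
    exact Nat.mul_le_mul_right _ (card_treeNode_le ht k)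
  have hmain : Fintype.card (TreeNode t k × Fin q) * (q * k) ^ 2 ≤
      64 * ∑ s, G.searchTime θ s := by
    calc _ ≤ 2 * t ^ k * q * (q * k) ^ 2 := Nat.mul_le_mul_right _ hcard
      _ = 2 * (t ^ k * (q ^ 3 * k ^ 2)) := by ring
      _ ≤ 2 * (2 * Bᶜ.card * (q ^ 3 * k ^ 2)) :=
        Nat.mul_le_mul_left _ (Nat.mul_le_mul_right _ hBc)
      _ = 4 * (Bᶜ.card * (q ^ 3 * k ^ 2)) := by ring
      _ ≤ 4 * (16 * _) := Nat.mul_le_mul_left _ hsum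
      _ = _ := by ring
  rw [avgQueryTime_eq]
  have hc : (0 : ℝ) < Fintype.card (TreeNode t k × Fin q) := by exact_mod_cast Fintype.card_pos
  rw [le_div_iff₀ hc]
  have : (Fintype.card (TreeNode t k × Fin q) : ℝ) * (q * k) ^ 2 ≤
      64 * ∑ s, (G.searchTime θ s : ℝ) := by exact_mod_cast hmain
  linarith

/-! ### Integral lengths and the choice of parameters. -/

theorem isIntegral_scale : ((treeCopiesGraph t k q).scale (2 ^ (k + 1))).IsIntegral := by
  intro X Y h
  refine ⟨copyDist X Y, ?_⟩
  rw [len_scale_of_adj _ h, div_self (by positivity), one_mul]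

/-- A tree of height `e + 2` with a large branching factor has the wanted highway dimension,
diameter, size and query time. -/
theorem exists_scale_treeCopiesGraph (h n e : ℕ) (D : ℝ) (hh : 1 ≤ h) (hD : 1 ≤ D) {m : ℝ≥0}
    (hm : 0 < m) (hlo : D ≤ m * 16 ^ (e + 1)) (hhi : (m : ℝ) * 16 ^ (e + 1) ≤ 128 * D)
    (hlog : D < 32 ^ (e + 1)) :
    ∃ t : ℕ, 2 ≤ t ∧
      ((treeCopiesGraph t (e + 2) h).scale m).highwayDimension = h ∧
      ENNReal.ofReal (1 * D) ≤ ((treeCopiesGraph t (e + 2) h).scale m).diam ∧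
      ((treeCopiesGraph t (e + 2) h).scale m).diam ≤ ENNReal.ofReal (384 * D) ∧
      n ≤ Fintype.card (TreeNode t (e + 2) × Fin h) ∧
      ∀ θ : Ordering (TreeNode t (e + 2) × Fin h),
        1 / 512 * (h * Real.log D) ^ 2 ≤
          ((treeCopiesGraph t (e + 2) h).scale m).avgQueryTime θ := by
  set k := e + 2 with hk
  set t := 2 + n + 2 * ((k + 1) ^ 2 * h * (h ^ 3 * k ^ 2)) with ht
  have ht2 : 2 ≤ t := by omega
  have hk1 : k - 1 = e + 1 := by omega
  refine ⟨t, ht2, highwayDimension_scale hm ht2 (by omega), ?_, ?_, ?_, fun θ => ?_⟩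
  · refine le_trans ?_ (le_diam_scale m ht2 (by omega) hh)
    rw [one_mul, ← ENNReal.ofReal_coe_nnreal, hk1]
    exact ENNReal.ofReal_le_ofReal (by push_cast; exact hlo)
  · refine (diam_scale_le m).trans ?_
    rw [← ENNReal.ofReal_coe_nnreal, hk1]
    refine ENNReal.ofReal_le_ofReal ?_
    push_cast
    linarith
  · rw [Fintype.card_prod, Fintype.card_fin]
    calc n ≤ t := by omega
      _ ≤ t ^ k := Nat.le_self_pow (by omega) t
      _ ≤ _ := pow_le_card_treeNode t k
      _ ≤ _ := Nat.le_mul_of_pos_right _ hh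
  · refine le_trans ?_ (le_avgQueryTime hm hh ht2 (by omega) θ)
    -- This accounts for the constant: `512 = 32 * 4 ^ 2`.
    have h1 : Real.log D ≤ 4 * k := by
      have h2 := Real.log_le_log (by linarith) hlog.le
      rw [Real.log_pow] at h2
      have h3 : Real.log 32 ≤ 4 := by
        rw [show (32 : ℝ) = 2 ^ 5 by norm_num, Real.log_pow]
        have := Real.log_two_lt_d9
        push_cast
        linarith
      calc Real.log D ≤ _ := h2
        _ ≤ (k : ℝ) * 4 := by
          refine mul_le_mul ?_ h3 (Real.log_nonneg (by norm_num)) (by positivity)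
          rw [hk]
          push_cast
          linarith
        _ = 4 * k := by ring
    have h2 : (h * Real.log D) ^ 2 ≤ (h * (4 * k)) ^ 2 :=
      pow_le_pow_left₀ (mul_nonneg (by positivity) (Real.log_nonneg hD))
        (mul_le_mul_of_nonneg_left h1 (by positivity)) 2
    calc _ ≤ 1 / 512 * ((h : ℝ) * (4 * k)) ^ 2 := by linarith
      _ = _ := by ring

end LenGraph

theorem mainTheorem3 :
    ∃ c C₁ C₂ : ℝ, 0 < c ∧ 0 < C₁ ∧ 0 < C₂ ∧
      ∀ (h : ℕ) (D : ℝ) (n : ℕ), 1 ≤ h → 1 ≤ D →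
        (∃ t k : ℕ, 2 ≤ t ∧ 2 ≤ k ∧
          (treeCopiesGraph t k h).highwayDimension = h ∧
          ENNReal.ofReal (C₁ * D) ≤ (treeCopiesGraph t k h).diam ∧
          (treeCopiesGraph t k h).diam ≤ ENNReal.ofReal (C₂ * D) ∧
          n ≤ Fintype.card (TreeNode t k × Fin h) ∧
          ∀ θ : LenGraph.Ordering (TreeNode t k × Fin h),
            c * (h * Real.log D) ^ 2 ≤ (treeCopiesGraph t k h).avgQueryTime θ) ∧
        (∃ t k : ℕ, 2 ≤ t ∧ 2 ≤ k ∧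
          ((treeCopiesGraph t k h).scale (2 ^ (k + 1))).IsIntegral ∧
          ((treeCopiesGraph t k h).scale (2 ^ (k + 1))).highwayDimension = h ∧
          ENNReal.ofReal (C₁ * D) ≤ ((treeCopiesGraph t k h).scale (2 ^ (k + 1))).diam ∧
          ((treeCopiesGraph t k h).scale (2 ^ (k + 1))).diam ≤ ENNReal.ofReal (C₂ * D) ∧
          n ≤ Fintype.card (TreeNode t k × Fin h) ∧
          ∀ θ : LenGraph.Ordering (TreeNode t k × Fin h),
            c * (h * Real.log D) ^ 2 ≤
              ((treeCopiesGraph t k h).scale (2 ^ (k + 1))).avgQueryTime θ) := by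
  refine ⟨1 / 512, 1, 384, by norm_num, by norm_num, by norm_num, fun h D n hh hD => ⟨?_, ?_⟩⟩
  -- Without scaling the diameter is between `16 ^ (e + 1)` and three times that, so `D` is
  -- bracketed by powers of 16.
  · obtain ⟨e, he1, he2⟩ := exists_nat_pow_near hD (by norm_num : (1 : ℝ) < 16)
    obtain ⟨t, ht, H⟩ := LenGraph.exists_scale_treeCopiesGraph h n e D hh hD (m := 1) one_pos
      (by rw [NNReal.coe_one, one_mul]; exact he2.le)
      (by rw [NNReal.coe_one, pow_succ]; linarith)
      (he2.trans_le (pow_le_pow_left₀ (by norm_num) (by norm_num) _))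
    simp only [LenGraph.scale_one] at H
    exact ⟨t, e + 2, ht, by omega, H⟩
  -- The scaling factor itself depends on the height `k = e + 2`: it turns `16 ^ (e + 1)` into `4 *
  -- 32 ^ (e + 1)`, so powers of 32 are used. Hence `128 = 4 * 32` and `384 = 3 * 128`.
  · obtain ⟨e, he1, he2⟩ := exists_nat_pow_near hD (by norm_num : (1 : ℝ) < 32)
    have h32 : (((2 ^ (e + 2 + 1) : ℝ≥0)) : ℝ) * 16 ^ (e + 1) = 4 * 32 ^ (e + 1) := by
      rw [show (32 : ℝ) = 2 * 16 by norm_num, mul_pow]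
      push_cast
      ring
    obtain ⟨t, ht, H⟩ := LenGraph.exists_scale_treeCopiesGraph h n e D hh hD (m := 2 ^ (e + 2 + 1))
      (by positivity) (by rw [h32]; linarith) (by rw [h32, pow_succ]; linarith) he2
    exact ⟨t, e + 2, ht, by omega, LenGraph.isIntegral_scale, H⟩
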